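/- **Setting.** Let $\Omega\subset\mathbb R^d$ be a bounded open set with homogeneous Dirichlet or homogeneous Neumann boundary conditions, or a box with periodic boundary conditions, and let $H$ be the corresponding space $H^1_0(\Omega)$, $H^1(\Omega)$ or $H^1_{per}(\Omega)$. The operator $-\Delta$ is understood weakly, with the boundary condition (tested against all $v\in H$). Let $F\in C^1(\mathbb R)$, $f=F'$, $\beta>0$, and $$\mathcal E[\phi]=\int_\Omega\Big(\tfrac12|\nabla\phi|^2+F(\phi)\Big)\,dx,\qquad p(z)=-(z+\beta)(z-\beta).$$ Given a one-step predictor $\Phi_\tau:H\to H$ ($\tau>0$), one step $\phi^n\mapsto\phi^{n+1}$ of the scheme PCC' with step size $\tau$ consists of 1. (predictor) $\tilde\phi=\Phi_\tau(\phi^n)$; 2. (maximum-bound projection) find $\phi_*^{n+1}\in L^2(\Omega)$ and a function $\lambda=\lambda(x)$ such that, almost everywhere, $\phi_*^{n+1}-\tilde\phi=\lambda\,p'(\phi_*^{n+1})$, $\lambda\ge0$, $p(\phi_*^{n+1})\ge0$, $\lambda\,p(\phi_*^{n+1})=0$; 3. (energy projection) find $\eta^{n+1}\in\mathbb R$ and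 $\phi^{n+1}\in H$, with $F(\phi^{n+1})$ integrable, such that $$\phi^{n+1}-\phi_*^{n+1}=-\eta^{n+1}\big[-\Delta\phi^{n+1}+f(\phi_*^{n+1})\big],$$ $$\eta^{n+1}\ge0,\qquad \mathcal E[\phi^{n+1}]-\mathcal E[\phi^n]\le0,\qquad \eta^{n+1}\big(\mathcal E[\phi^{n+1}]-\mathcal E[\phi^n]\big)=0.$$ Let $K\subset H$ be a compact set of states (for instance $K=\{\phi^n\}$ for a single state, or a compact set containing all the time levels under consideration) such that every $\phi\in K$ satisfies $\|\phi\|_{L^\infty}\le\beta$, and such that, for some constant $\tilde\epsilon>0$, the residual assumption $$\|-\Delta\phi+f(\phi)\|_{L^2}^2\ge\tilde\epsilon\qquad\text{for all }\phi\in K$$ holds (the norm being $+\infty$ if $-\Delta\phi+f(\phi)\notin L^2(\Omega)$). Assume that the predictor is consistent at $\tau=0$ on $K$: $\Phi_\tau(\phi)\to\phi$ in $H^1$ as $\tau\to0^+$, uniformly for $\phi\in K$. **Theorem (Properties of PCC').** There exist constants $\tau_2>0$ and $\bar\eta>0$ such that for every $0<\tau<\tau_2$ the following hold. * *(Unique solvability.)*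 For every $\phi^n\in K$, step 2 determines a unique $\phi_*^{n+1}$, and the nonlinear system of step 3 has a unique solution $(\eta^{n+1},\phi^{n+1})$ with $\eta^{n+1}\in[0,\bar\eta]$. In particular the multiplier $\eta^{n+1}\in[0,\bar\eta]$ exists and is unique. * *(Maximum bound and energy decay.)* Suppose moreover that $f\in C^1(\mathbb R)$, $f(z)\le0$ for $z\le-\beta$ and $f(z)\ge0$ for $z\ge\beta$. Then for every $N\in\mathbb N$, every numerical solution $\phi^0,\dots,\phi^N\in H$ of PCC' with step size $\tau$, $\|\phi^0\|_{L^\infty}\le\beta$ and multipliers $\eta^{1},\dots,\eta^{N}\in[0,\bar\eta]$ (whether or not the $\phi^n$ lie in $K$) satisfies $$\|\phi^n\|_{L^\infty}\le\beta\quad(0\le n\le N),\qquad \mathcal E[\phi^{n+1}]\le\mathcal E[\phi^n]\quad(0\le n<N).$$ -/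

import Mathlib

open MeasureTheory Filter Topology
open scoped ContDiff ENNReal

noncomputable section

namespace PCC

/-- Euclidean space of dimension `d`. -/
abbrev Space (d : ℕ) : Type := EuclideanSpace ℝ (Fin d)

/-- A bounded spatial domain together with one of the boundary conditions under which boundary
terms vanish upon integrating by parts: homogeneous Dirichlet, homogeneous Neumann, or periodic
(on a box with corners `a` and `b`). -/
inductive Domain (d : ℕ) : Type where
  | dirichlet (Ω : Set (Space d)) (isOpen : IsOpen Ω) (isBounded : Bornology.IsBounded Ω) :
      Domain d
  | neumann (Ω : Set (Space d)) (isOpen : IsOpen Ω) (isBounded : Bornology.IsBounded Ω) :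
      Domain d
  | periodic (a b : Fin d → ℝ) (lt : ∀ i, a i < b i) : Domain d

namespace Domain

variable {d : ℕ}

/-- The spatial domain `Ω`. -/
def carrier : Domain d → Set (Space d)
  | dirichlet Ω _ _ => Ω
  | neumann Ω _ _ => Ω
  | periodic a b _ => {x | ∀ i, a i < x i ∧ x i < b i}

/-- Lebesgue measure on `Ω`. -/
def vol (D : Domain d) : Measure (Space d) := volume.restrict D.carrier

/-- The smooth functions compatible with the boundary condition: `C_c^∞(Ω)` for Dirichlet
conditions, `C^∞(Ω)` for Neumann conditions, smooth periodic functions for periodic ones. -/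
def IsSmooth : Domain d → (Space d → ℝ) → Prop
  | dirichlet Ω _ _, ψ => ContDiff ℝ ∞ ψ ∧ HasCompactSupport ψ ∧ tsupport ψ ⊆ Ω
  | neumann Ω _ _, ψ => ContDiffOn ℝ ∞ ψ Ω
  | periodic a b _, ψ => ContDiff ℝ ∞ ψ ∧
      ∀ i x, ψ (x + EuclideanSpace.single i (b i - a i)) = ψ x

/-- Real `L²(Ω)`. -/
abbrev L2 (D : Domain d) : Type := Lp ℝ 2 D.vol

/-- Pairs (function, vector field) in `L²(Ω) × L²(Ω; ℝ^d)`, with the Hilbert norm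
`(‖u‖² + ‖g‖²)^{1/2}`. -/
abbrev Pairs (D : Domain d) : Type := WithLp 2 (Lp ℝ 2 D.vol × Lp (Space d) 2 D.vol)

/-- The Sobolev space `H¹` adapted to the boundary condition (`H¹_0(Ω)`, `H¹(Ω)` or `H¹_per(Ω)`),
an element being recorded as the pair `(u, ∇u)`: the closure, in the `H¹` norm, of the smooth
functions of finite norm that are compatible with the boundary condition. For Neumann conditions
this is all of `H¹(Ω) = W^{1,2}(Ω)` (Meyers-Serrin), the condition itself being the natural one. -/
def H1 (D : Domain d) : Submodule ℝ D.Pairs :=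
  (Submodule.span ℝ {p : D.Pairs | ∃ ψ : Space d → ℝ, D.IsSmooth ψ ∧
    (p.fst =ᵐ[D.vol] ψ) ∧ (p.snd =ᵐ[D.vol] gradient ψ)}).topologicalClosure

/-- The function underlying an element of `H¹`. -/
def fn {D : Domain d} (φ : D.H1) : D.L2 := φ.1.fst

/-- The weak gradient of an element of `H¹`. -/
def grad {D : Domain d} (φ : D.H1) : Lp (Space d) 2 D.vol := φ.1.snd

/-- The free energy `∫_Ω (|∇φ|²/2 + F(φ)) dx`; meaningful when `F(φ)` is integrable. -/
def energy (D : Domain d) (F : ℝ → ℝ) (φ : D.H1) : ℝ :=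
  ∫ x, (1 / 2 * ‖grad φ x‖ ^ 2 + F (fn φ x)) ∂D.vol

/-- `‖u‖_{L^∞(Ω)} ≤ β`. -/
def MaxBound (D : Domain d) (β : ℝ) (u : D.L2) : Prop :=
  eLpNorm u ∞ D.vol ≤ ENNReal.ofReal β

/-- `r = -Δφ + f(φ)` with `r ∈ L²(Ω)`, where `-Δ` is taken in the weak sense, with the boundary
condition. -/
def IsResidual (D : Domain d) (f : ℝ → ℝ) (φ : D.H1) (r : D.L2) : Prop :=
  ∀ v : D.H1,
    (∫ x, inner ℝ (grad φ x) (grad v x) ∂D.vol) + (∫ x, f (fn φ x) * fn v x ∂D.vol) =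
      ∫ x, r x * fn v x ∂D.vol

/-- `‖-Δφ + f(φ)‖² ≥ ε` in `L²(Ω)`, the norm being `+∞` if `-Δφ + f(φ)` is not in `L²(Ω)`. -/
def Unsteady (D : Domain d) (f : ℝ → ℝ) (ε : ℝ) (φ : D.H1) : Prop :=
  ∀ r : D.L2, D.IsResidual f φ r → ε ≤ ‖r‖ ^ 2

/-- The quadratic function `p(z) = -(z + β)(z - β)`; the bound `|z| ≤ β` reads `p(z) ≥ 0`. -/
def p (β z : ℝ) : ℝ := -(z + β) * (z - β)

/-- Maximum-bound projection of `u`: there is a multiplier `lam = lam(x)` with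
`w - u = lam p'(w)`, `lam ≥ 0`, `p(w) ≥ 0`, `lam p(w) = 0` almost everywhere. -/
def IsBoundProjection (D : Domain d) (β : ℝ) (u w : D.L2) : Prop :=
  ∃ lam : Space d → ℝ, ∀ᵐ x ∂D.vol,
    w x - u x = lam x * deriv (p β) (w x) ∧ 0 ≤ lam x ∧ 0 ≤ p β (w x) ∧ lam x * p β (w x) = 0

/-- Energy-stable projection: the multiplier `η` and the new state `ψ` solve, given the old state
`φ` and the intermediate state `w`,
`ψ - w = -η [-Δψ + f(w)]` (weakly, with the boundary condition), `η ≥ 0`, `E[ψ] - E[φ] ≤ 0`,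
`η (E[ψ] - E[φ]) = 0`, the energy of `ψ` being finite. -/
structure IsEnergyProjection (D : Domain d) (F f : ℝ → ℝ) (φ : D.H1) (w : D.L2)
    (η : ℝ) (ψ : D.H1) : Prop where
  eqn : ∀ v : D.H1, ∫ x, (fn ψ x - w x) * fn v x ∂D.vol =
    -η * ((∫ x, inner ℝ (grad ψ x) (grad v x) ∂D.vol) + ∫ x, f (w x) * fn v x ∂D.vol)
  multiplier_nonneg : 0 ≤ η
  integrable : Integrable (fun x => F (fn ψ x)) D.vol
  energy_le : D.energy F ψ - D.energy F φ ≤ 0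
  complementary : η * (D.energy F ψ - D.energy F φ) = 0

/-- One time step of the scheme with predictor `Φ` (the map `Φ_τ` for the current step size):
prediction, then maximum-bound projection, then energy-stable projection with multiplier `η`. -/
def IsStep (D : Domain d) (F f : ℝ → ℝ) (β : ℝ) (Φ : D.H1 → D.H1) (φ : D.H1) (η : ℝ)
    (ψ : D.H1) : Prop :=
  ∃ w : D.L2, D.IsBoundProjection β (fn (Φ φ)) w ∧ D.IsEnergyProjection F f φ w η ψ

end Domain

/-- The sign condition on the nonlinearity: `f` is `C¹`, `f ≤ 0` on `(-∞, -β]` and `f ≥ 0` on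
`[β, ∞)`. -/
def SignCondition (f : ℝ → ℝ) (β : ℝ) : Prop :=
  ContDiff ℝ 1 f ∧ (∀ z, z ≤ -β → f z ≤ 0) ∧ (∀ z, β ≤ z → 0 ≤ f z)

end PCC

end

/-! Step 2 is pointwise truncation to [-β, β] (`isBoundProjection_iff`), and truncation keeps H¹
invariant without increasing the gradient norm (`exists_clip`). Let W be the truncated predictor and
g = f(W). For fixed η ≥ 0 the equation of step 3 is linear in the new state and has exactly one
solution ψ(η), with ψ(0) = W. Step 3 thus becomes a scalar problem: find η in [0, T] with E[ψ(η)] ≤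
E[φ], and equality unless η = 0. If E[ψ(η)] is continuous and falls at rate at least k > 0, and E[W]
- E[φ] ≤ kT, then intermediate values and strict monotonicity settle it
(`existsUnique_isEnergyProjection`). The last inequality is where small τ enters.

For the rate, let η₁ < η₂ and δ = ψ(η₂) - ψ(η₁). Then δ - η₁Δδ = -(η₂ - η₁)(-Δψ(η₂) + g) weakly, and
testing with δ bounds (η₂ - η₁) times the energy change by -‖δ‖² plus a small multiple of (η₂ -
η₁)‖δ‖ (`Solves.mul_energy_sub_le`). It remains to show ‖δ‖ ≥ (√ε/2)(η₂ - η₁) uniformly near K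
(`exists_speed_lower_bound`). Otherwise the difference quotients have a weak L² limit of norm at
most √ε/2, which is the residual of some state in K: a contradiction.

By the weak maximum principle (`Solves.ae_abs_le`) ψ(η) obeys any bound on |W - ηf(W)|. This gives a
crude bound β + M in general, so that f and F matter only on a compact interval, and the bound β
under the sign condition when η is small. -/

noncomputable section

/-! ### Weak limits in Hilbert spaces -/

/-- A bounded family in a Hilbert space has a weak limit along every ultrafilter. -/
theorem exists_weak_limit_of_bounded {ι E : Type*} [NormedAddCommGroup E] [InnerProductSpace ℝ E]
    [CompleteSpace E] (l : Ultrafilter ι) (x : ι → E) (C : ℝ) (hx : ∀ᶠ i in l, ‖x i‖ ≤ C) :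
    ∃ y : E, ∀ z : E, Tendsto (fun i => inner ℝ (x i) z) l (𝓝 (inner ℝ y z)) := by
  have hb : ∀ z, ∀ᶠ i in l, inner ℝ (x i) z ∈ Set.Icc (-(C * ‖z‖)) (C * ‖z‖) := by
    intro z
    filter_upwards [hx] with i hi
    have h := abs_real_inner_le_norm (x i) z
    have h2 : ‖x i‖ * ‖z‖ ≤ C * ‖z‖ := by gcongr
    exact abs_le.1 (h.trans h2)
  have hlim : ∀ z, ∃ a ∈ Set.Icc (-(C * ‖z‖)) (C * ‖z‖),
      Tendsto (fun i => inner ℝ (x i) z) l (𝓝 a) := by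
    intro z
    obtain ⟨a, ha, hl⟩ := isCompact_iff_ultrafilter_le_nhds.1 isCompact_Icc
      (l.map fun i => inner ℝ (x i) z) (le_principal_iff.2 (hb z))
    exact ⟨a, ha, hl⟩
  choose a ha hlim using hlim
  -- The limits along the ultrafilter are linear in z and bounded by C‖z‖; Riesz representation
  -- supplies the vector.
  let L : E →ₗ[ℝ] ℝ :=
    { toFun := a
      map_add' := fun z w => tendsto_nhds_unique (hlim _)
        (by simpa only [inner_add_right] using (hlim z).add (hlim w))
      map_smul' := fun c z => tendsto_nhds_unique (hlim _)
        (by simpa [inner_smul_right] using (hlim z).const_mul c) }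
  let Lc : E →L[ℝ] ℝ := L.mkContinuous C fun z => abs_le.2 (ha z)
  refine ⟨(InnerProductSpace.toDual ℝ E).symm Lc, fun z => ?_⟩
  rw [InnerProductSpace.toDual_symm_apply]
  exact hlim z

theorem norm_le_of_weak_limit {ι E : Type*} [NormedAddCommGroup E] [InnerProductSpace ℝ E]
    {l : Filter ι} [l.NeBot] {x : ι → E} {y : E} {C : ι → ℝ} {c : ℝ}
    (hxy : Tendsto (fun i => inner ℝ (x i) y) l (𝓝 (inner ℝ y y)))
    (hx : ∀ᶠ i in l, ‖x i‖ ≤ C i) (hC : Tendsto C l (𝓝 c)) : ‖y‖ ≤ c := by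
  have h : inner ℝ y y ≤ c * ‖y‖ := by
    refine le_of_tendsto_of_tendsto hxy (hC.mul_const ‖y‖) ?_
    filter_upwards [hx] with i hi
    exact (real_inner_le_norm _ _).trans (by gcongr)
  rw [real_inner_self_eq_norm_sq, sq] at h
  have hc : 0 ≤ c := ge_of_tendsto hC (hx.mono fun i hi => (norm_nonneg _).trans hi)
  rcases eq_or_lt_of_le (norm_nonneg y) with h0 | h0
  · rwa [← h0]
  · exact le_of_mul_le_mul_right h h0

/-! ### The spaces H¹ as closures of smooth pairs -/

namespace PCC.Domain

variable {d : ℕ} {D : Domain d}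

theorem isOpen_carrier (D : Domain d) : IsOpen D.carrier := by
  cases D with
  | dirichlet Ω h _ => exact h
  | neumann Ω h _ => exact h
  | periodic a b _ =>
    have h : {x : Space d | ∀ i, a i < x i ∧ x i < b i} =
        ⋂ i, {x : Space d | a i < x i} ∩ {x : Space d | x i < b i} := by
      ext x; simp
    simp only [carrier]
    rw [h]
    refine isOpen_iInter_of_finite fun i => ?_
    have hc : Continuous fun x : Space d => x i := by fun_prop
    exact (isOpen_lt continuous_const hc).inter (isOpen_lt hc continuous_const)

theorem isBounded_carrier (D : Domain d) : Bornology.IsBounded D.carrier := by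
  cases D with
  | dirichlet Ω _ h => exact h
  | neumann Ω _ h => exact h
  | periodic a b _ =>
    have hc : IsCompact ((EuclideanSpace.equiv (Fin d) ℝ).symm '' Set.Icc a b) :=
      isCompact_Icc.image (EuclideanSpace.equiv (Fin d) ℝ).symm.continuous
    refine hc.isBounded.subset fun x hx => ⟨EuclideanSpace.equiv (Fin d) ℝ x, ?_, by simp⟩
    exact ⟨fun i => (hx i).1.le, fun i => (hx i).2.le⟩

instance (D : Domain d) : IsFiniteMeasure D.vol :=
  ⟨by
    rw [vol, Measure.restrict_apply_univ]
    exact D.isBounded_carrier.measure_lt_top⟩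

theorem IsSmooth.contDiffOn {ψ : Space d → ℝ} (h : D.IsSmooth ψ) :
    ContDiffOn ℝ ∞ ψ D.carrier := by
  cases D with
  | dirichlet Ω _ _ => exact h.1.contDiffOn
  | neumann Ω _ _ => exact h
  | periodic a b _ => exact h.1.contDiffOn

theorem IsSmooth.differentiableAt {ψ : Space d → ℝ} (h : D.IsSmooth ψ) {x : Space d}
    (hx : x ∈ D.carrier) : DifferentiableAt ℝ ψ x :=
  (h.contDiffOn.contDiffAt (D.isOpen_carrier.mem_nhds hx)).differentiableAt (by simp)

theorem ae_mem_carrier (D : Domain d) : ∀ᵐ x ∂D.vol, x ∈ D.carrier :=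
  ae_restrict_mem D.isOpen_carrier.measurableSet

theorem isSmooth_zero (D : Domain d) : D.IsSmooth 0 := by
  cases D with
  | dirichlet Ω _ _ =>
    exact ⟨contDiff_const, HasCompactSupport.zero, by simp [tsupport]⟩
  | neumann Ω _ _ => exact contDiffOn_const
  | periodic a b _ => exact ⟨contDiff_const, by simp⟩

theorem IsSmooth.add {ψ χ : Space d → ℝ} (hψ : D.IsSmooth ψ) (hχ : D.IsSmooth χ) :
    D.IsSmooth (ψ + χ) := by
  cases D with
  | dirichlet Ω _ _ =>
    exact ⟨hψ.1.add hχ.1, hψ.2.1.add hχ.2.1,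
      (tsupport_add ψ χ).trans (Set.union_subset hψ.2.2 hχ.2.2)⟩
  | neumann Ω _ _ => exact ContDiffOn.add hψ hχ
  | periodic a b _ => exact ⟨hψ.1.add hχ.1, fun i x => by simp [hψ.2, hχ.2]⟩

/-- The condition θ 0 = 0 keeps the support compact in the Dirichlet case. -/
theorem IsSmooth.comp {ψ : Space d → ℝ} (hψ : D.IsSmooth ψ) {θ : ℝ → ℝ} (hθ : ContDiff ℝ ∞ θ)
    (h0 : θ 0 = 0) : D.IsSmooth (θ ∘ ψ) := by
  cases D with
  | dirichlet Ω _ _ =>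
    exact ⟨hθ.comp hψ.1, hψ.2.1.comp_left h0, (tsupport_comp_subset h0 ψ).trans hψ.2.2⟩
  | neumann Ω _ _ => exact hθ.comp_contDiffOn hψ
  | periodic a b _ => exact ⟨hθ.comp hψ.1, fun i x => by simp [hψ.2]⟩

theorem IsSmooth.const_smul {ψ : Space d → ℝ} (hψ : D.IsSmooth ψ) (c : ℝ) :
    D.IsSmooth (c • ψ) :=
  hψ.comp (θ := fun z => c * z) (by fun_prop) (by simp)

/-- The pairs consisting of a smooth function and its gradient. -/
def smoothPairs (D : Domain d) : Set D.Pairs :=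
  {p : D.Pairs | ∃ ψ : Space d → ℝ, D.IsSmooth ψ ∧
    (p.fst =ᵐ[D.vol] ψ) ∧ (p.snd =ᵐ[D.vol] gradient ψ)}

theorem gradient_comp {ψ : Space d → ℝ} {x : Space d} (hψ : DifferentiableAt ℝ ψ x) {θ : ℝ → ℝ}
    (hθ : DifferentiableAt ℝ θ (ψ x)) :
    gradient (θ ∘ ψ) x = deriv θ (ψ x) • gradient ψ x := by
  simp only [gradient]
  rw [(hθ.hasDerivAt.comp_hasFDerivAt x hψ.hasFDerivAt).fderiv, map_smulₛₗ]
  simp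

/-- Each element of H¹ is therefore a limit of single smooth pairs, to which nonlinear compositions
can be applied. -/
theorem span_smoothPairs (D : Domain d) :
    (Submodule.span ℝ D.smoothPairs : Set D.Pairs) = D.smoothPairs := by
  refine Set.Subset.antisymm (fun p hp => ?_) Submodule.subset_span
  induction hp using Submodule.span_induction with
  | mem p hp => exact hp
  | zero =>
    refine ⟨0, D.isSmooth_zero, Lp.coeFn_zero _ _ _, ?_⟩
    refine (Lp.coeFn_zero (Space d) 2 D.vol).trans (Eventually.of_forall fun x => ?_)
    simp only [gradient]
    rw [fderiv_zero]; simp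
  | add p q _ _ hp hq =>
    obtain ⟨ψ, hψ, h1, h2⟩ := hp
    obtain ⟨χ, hχ, h3, h4⟩ := hq
    refine ⟨ψ + χ, hψ.add hχ, ?_, ?_⟩
    · filter_upwards [Lp.coeFn_add p.fst q.fst, h1, h3] with x hx h1 h3
      rw [WithLp.add_fst, hx, Pi.add_apply, h1, h3, Pi.add_apply]
    · filter_upwards [Lp.coeFn_add p.snd q.snd, h2, h4, D.ae_mem_carrier] with x hx h2 h4 hm
      rw [WithLp.add_snd, hx, Pi.add_apply, h2, h4]
      simp only [gradient]
      rw [fderiv_add (hψ.differentiableAt hm) (hχ.differentiableAt hm), map_add]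
  | smul c p _ hp =>
    obtain ⟨ψ, hψ, h1, h2⟩ := hp
    refine ⟨c • ψ, hψ.const_smul c, ?_, ?_⟩
    · filter_upwards [Lp.coeFn_smul c p.fst, h1] with x hx h1
      rw [WithLp.smul_fst, hx, Pi.smul_apply, h1, Pi.smul_apply]
    · filter_upwards [Lp.coeFn_smul c p.snd, h2, D.ae_mem_carrier] with x hx h2 hm
      rw [WithLp.smul_snd, hx, Pi.smul_apply, h2]
      simp only [gradient]
      rw [fderiv_const_smul (hψ.differentiableAt hm), map_smulₛₗ]
      simp

theorem mem_H1_iff {p : D.Pairs} : p ∈ D.H1 ↔ p ∈ closure D.smoothPairs := by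
  rw [← span_smoothPairs]; rfl

instance : CompleteSpace D.H1 := by
  unfold H1; infer_instance

/-- The underlying function, as a continuous linear map. -/
def fnL (D : Domain d) : D.H1 →L[ℝ] D.L2 := (WithLp.fstL 2 ℝ _ _).comp D.H1.subtypeL

/-- The weak gradient, as a continuous linear map. -/
def gradL (D : Domain d) : D.H1 →L[ℝ] Lp (Space d) 2 D.vol :=
  (WithLp.sndL 2 ℝ _ _).comp D.H1.subtypeL

theorem fnL_apply (u : D.H1) : D.fnL u = fn u := rfl
theorem gradL_apply (u : D.H1) : D.gradL u = grad u := rfl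

theorem continuous_fn : Continuous (fn : D.H1 → D.L2) := D.fnL.continuous
theorem continuous_grad : Continuous (grad : D.H1 → _) := D.gradL.continuous

@[simp] theorem fn_add (u v : D.H1) : fn (u + v) = fn u + fn v := map_add D.fnL u v
@[simp] theorem fn_sub (u v : D.H1) : fn (u - v) = fn u - fn v := map_sub D.fnL u v
@[simp] theorem fn_smul (c : ℝ) (u : D.H1) : fn (c • u) = c • fn u := map_smul D.fnL c u
@[simp] theorem fn_zero : fn (0 : D.H1) = 0 := map_zero D.fnL
@[simp] theorem grad_add (u v : D.H1) : grad (u + v) = grad u + grad v := map_add D.gradL u v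
@[simp] theorem grad_sub (u v : D.H1) : grad (u - v) = grad u - grad v := map_sub D.gradL u v
@[simp] theorem grad_smul (c : ℝ) (u : D.H1) : grad (c • u) = c • grad u := map_smul D.gradL c u
@[simp] theorem grad_zero : grad (0 : D.H1) = 0 := map_zero D.gradL

theorem norm_sq_eq (u : D.H1) : ‖u‖ ^ 2 = ‖fn u‖ ^ 2 + ‖grad u‖ ^ 2 :=
  WithLp.prod_norm_sq_eq_of_L2 u.1

theorem norm_fn_le (u : D.H1) : ‖fn u‖ ≤ ‖u‖ := by
  refine le_of_sq_le_sq ?_ (norm_nonneg _)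
  nlinarith [norm_sq_eq u, sq_nonneg ‖grad u‖]

theorem norm_grad_le (u : D.H1) : ‖grad u‖ ≤ ‖u‖ := by
  refine le_of_sq_le_sq ?_ (norm_nonneg _)
  nlinarith [norm_sq_eq u, sq_nonneg ‖fn u‖]

theorem norm_le_add (u : D.H1) : ‖u‖ ≤ ‖fn u‖ + ‖grad u‖ := by
  refine le_of_sq_le_sq ?_ (by positivity)
  nlinarith [norm_sq_eq u, norm_nonneg (fn u), norm_nonneg (grad u),
    mul_nonneg (norm_nonneg (fn u)) (norm_nonneg (grad u))]

end PCC.Domain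

/-! ### Weak gradients and weak compactness in H¹ -/

namespace PCC.Domain

variable {d : ℕ} {D : Domain d}

theorem integrable_of_continuousOn_tsupport {ξ : Space d → ℝ} (hξ : HasCompactSupport ξ)
    {g : Space d → ℝ} (hg : ContinuousOn g (tsupport ξ)) (hs : Function.support g ⊆ tsupport ξ) :
    Integrable g volume :=
  (integrableOn_iff_integrable_of_support_subset hs).1 (hg.integrableOn_compact hξ)

/-- Integration by parts of a smooth function against a test function. -/
theorem IsSmooth.integral_mul_fderiv {ψ ξ : Space d → ℝ} (hψ : D.IsSmooth ψ)
    (hξ : ContDiff ℝ ∞ ξ) (hc : HasCompactSupport ξ) (hs : tsupport ξ ⊆ D.carrier) (v : Space d) :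
    ∫ x, ψ x * fderiv ℝ ξ x v ∂D.vol = - ∫ x, inner ℝ (gradient ψ x) v * ξ x ∂D.vol := by
  have hψc : ContinuousOn ψ (tsupport ξ) := hψ.contDiffOn.continuousOn.mono hs
  have hψd : ContinuousOn (fun x => fderiv ℝ ψ x v) (tsupport ξ) :=
    ((hψ.contDiffOn.continuousOn_fderiv_of_isOpen D.isOpen_carrier (by simp)).mono hs).clm_apply
      continuousOn_const
  have hξd : Continuous fun x => fderiv ℝ ξ x v :=
    (hξ.continuous_fderiv (by simp)).clm_apply continuous_const
  have hsub : Function.support (fun x => fderiv ℝ ξ x v) ⊆ tsupport ξ := by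
    refine Set.Subset.trans (fun x hx => ?_) (support_fderiv_subset ℝ)
    rw [Function.mem_support] at hx ⊢
    intro h0; exact hx (by simp [h0])
  have key := integral_mul_fderiv_eq_neg_fderiv_mul_of_integrable (μ := (volume : Measure (Space d)))
    (f := ψ) (g := ξ) (v := v)
    (integrable_of_continuousOn_tsupport hc (hψd.mul hξ.continuous.continuousOn)
      ((Function.support_mul_subset_right _ _).trans (subset_tsupport _)))
    (integrable_of_continuousOn_tsupport hc (hψc.mul hξd.continuousOn)
      ((Function.support_mul_subset_right _ _).trans hsub))
    (integrable_of_continuousOn_tsupport hc (hψc.mul hξ.continuous.continuousOn)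
      ((Function.support_mul_subset_right _ _).trans (subset_tsupport _)))
    (fun x hx => hψ.differentiableAt (hs hx))
    (fun x _ => hξ.differentiable (by simp) x)
  have hg : ∀ x, inner ℝ (gradient ψ x) v = fderiv ℝ ψ x v := fun x => by
    simp only [gradient]
    rw [InnerProductSpace.toDual_symm_apply]
  simp only [hg, vol]
  rw [setIntegral_eq_integral_of_forall_compl_eq_zero, key,
    setIntegral_eq_integral_of_forall_compl_eq_zero]
  · intro x hx
    rw [image_eq_zero_of_notMem_tsupport (fun h => hx (hs h)), mul_zero]
  · intro x hx
    have : fderiv ℝ ξ x v = 0 := by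
      by_contra h
      exact hx (hs (hsub h))
    rw [this, mul_zero]

/-- The weak gradient satisfies integration by parts against test functions. -/
theorem integral_fn_mul_fderiv (u : D.H1) {ξ : Space d → ℝ}
    (hξ : ContDiff ℝ ∞ ξ) (hc : HasCompactSupport ξ) (hs : tsupport ξ ⊆ D.carrier) (v : Space d) :
    ∫ x, fn u x * fderiv ℝ ξ x v ∂D.vol = - ∫ x, inner ℝ (grad u x) v * ξ x ∂D.vol := by
  have hξd : Continuous fun x => fderiv ℝ ξ x v :=
    (hξ.continuous_fderiv (by simp)).clm_apply continuous_const
  have hξdc : HasCompactSupport fun x => fderiv ℝ ξ x v := hc.fderiv_apply ℝ v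
  have m1 : MemLp (fun x => fderiv ℝ ξ x v) 2 D.vol := hξd.memLp_of_hasCompactSupport hξdc
  have m2 : MemLp (fun x => ξ x • v) 2 D.vol :=
    (hξ.continuous.smul continuous_const).memLp_of_hasCompactSupport hc.smul_right
  have e1 : ∀ p : D.Pairs, inner ℝ (m1.toLp) p.fst = ∫ x, p.fst x * fderiv ℝ ξ x v ∂D.vol := by
    intro p
    rw [L2.inner_def]
    refine integral_congr_ae ?_
    filter_upwards [m1.coeFn_toLp] with x hx
    rw [hx]; simp
  have e2 : ∀ p : D.Pairs, inner ℝ (m2.toLp) p.snd = ∫ x, inner ℝ (p.snd x) v * ξ x ∂D.vol := by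
    intro p
    rw [L2.inner_def]
    refine integral_congr_ae ?_
    filter_upwards [m2.coeFn_toLp] with x hx
    rw [hx, real_inner_smul_left, real_inner_comm, mul_comm]
  -- Both sides are inner products with fixed L² elements, hence continuous in the pair, so smooth
  -- pairs suffice.
  suffices h : ∀ p ∈ D.H1, inner ℝ (m1.toLp) p.fst = - inner ℝ (m2.toLp) p.snd by
    have := h u.1 u.2
    rwa [e1, e2] at this
  intro p hp
  rw [mem_H1_iff] at hp
  have hclosed : IsClosed {p : D.Pairs | inner ℝ (m1.toLp) p.fst = - inner ℝ (m2.toLp) p.snd} :=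
    isClosed_eq (continuous_const.inner (WithLp.fstL 2 ℝ _ _).continuous)
      (continuous_const.inner (WithLp.sndL 2 ℝ _ _).continuous).neg
  refine closure_minimal ?_ hclosed hp
  rintro q ⟨ψ, hψ, h1, h2⟩
  rw [Set.mem_ofPred_eq, e1, e2]
  rw [integral_congr_ae (g := fun x => ψ x * fderiv ℝ ξ x v) (h1.mono fun x hx => by simp [hx]),
    hψ.integral_mul_fderiv hξ hc hs,
    integral_congr_ae (f := fun x => inner ℝ (q.snd x) v * ξ x)
      (g := fun x => inner ℝ (gradient ψ x) v * ξ x) (h2.mono fun x hx => by simp [hx])]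

/-- Elements of H¹ are pairs, so closability of the gradient has to be proved: integration by parts
annihilates every test function, and the fundamental lemma of the calculus of variations applies to
each component. -/
theorem grad_eq_zero_of_fn_eq_zero {u : D.H1} (hu : fn u = 0) : grad u = 0 := by
  have hcomp : ∀ i : Fin d, ∀ᵐ x ∂D.vol, grad u x i = 0 := by
    intro i
    have hint : Integrable (fun x => grad u x i) D.vol := by
      have h1 : Integrable (grad u) D.vol := (Lp.memLp (grad u)).integrable (by norm_num)
      exact (EuclideanSpace.proj (𝕜 := ℝ) i).integrable_comp h1
    have h := D.isOpen_carrier.ae_eq_zero_of_integral_contDiff_smul_eq_zero (μ := D.vol)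
      (hint.locallyIntegrable.locallyIntegrableOn _) (fun ξ hξ hc hs => by
        have h := integral_fn_mul_fderiv u (hξ) hc hs (EuclideanSpace.single i 1)
        have h0 : ∫ x, fn u x * fderiv ℝ ξ x (EuclideanSpace.single i 1) ∂D.vol = 0 := by
          refine integral_eq_zero_of_ae ?_
          have : fn u =ᵐ[D.vol] 0 := by rw [hu]; exact Lp.coeFn_zero _ _ _
          filter_upwards [this] with x hx
          simp [hx]
        rw [h0, eq_comm, neg_eq_zero] at h
        rw [← h]
        refine integral_congr_ae (Eventually.of_forall fun x => ?_)
        simp [EuclideanSpace.inner_single_right, mul_comm])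
    filter_upwards [h, D.ae_mem_carrier] with x hx hm using hx hm
  rw [Lp.eq_zero_iff_ae_eq_zero]
  filter_upwards [ae_all_iff.2 hcomp] with x hx
  ext i
  exact hx i

theorem fn_injective : Function.Injective (fn : D.H1 → D.L2) := by
  intro u v h
  have h0 : fn (u - v) = 0 := by rw [fn_sub, h, sub_self]
  have h1 := norm_sq_eq (u - v)
  rw [h0, grad_eq_zero_of_fn_eq_zero h0] at h1
  have : ‖u - v‖ = 0 := by simpa using h1
  exact sub_eq_zero.1 (norm_eq_zero.1 this)

/-- Weak compactness in `H¹`, the limit of the functions being known in `L²`. -/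
theorem exists_weak_limit {ι : Type*} (l : Ultrafilter ι) (u : ι → D.H1) {w : D.L2}
    (hw : Tendsto (fun i => fn (u i)) l (𝓝 w)) (C : ℝ) (hC : ∀ᶠ i in l, ‖grad (u i)‖ ≤ C) :
    ∃ W : D.H1, fn W = w ∧
      ∀ v : D.H1, Tendsto (fun i => inner ℝ (grad (u i)) (grad v)) l
        (𝓝 (inner ℝ (grad W) (grad v))) := by
  have hb : ∀ᶠ i in l, ‖u i‖ ≤ (‖w‖ + 1) + C := by
    filter_upwards [hC, hw.norm.eventually (eventually_le_nhds (lt_add_one ‖w‖))] with i h1 h2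
    exact (norm_le_add _).trans (add_le_add h2 h1)
  obtain ⟨W, hW⟩ := exists_weak_limit_of_bounded l u _ hb
  have hfn : fn W = w := by
    refine ext_inner_right ℝ fun z => ?_
    -- Adjoints turn weak convergence in H¹ into weak convergence of the functions and of the
    -- gradients.
    have h1 := hW ((ContinuousLinearMap.adjoint D.fnL) z)
    simp only [ContinuousLinearMap.adjoint_inner_right, fnL_apply] at h1
    exact tendsto_nhds_unique h1 (hw.inner tendsto_const_nhds)
  refine ⟨W, hfn, fun v => ?_⟩
  have h1 := hW ((ContinuousLinearMap.adjoint D.gradL) (grad v))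
  simpa only [ContinuousLinearMap.adjoint_inner_right, gradL_apply] using h1

/-- Strong convergence in `L²` and boundedness in `H¹` give weak convergence of the gradients. -/
theorem tendsto_inner_grad {ι : Type*} {l : Filter ι} {u : ι → D.H1} {W : D.H1}
    (hw : Tendsto (fun i => fn (u i)) l (𝓝 (fn W))) (C : ℝ) (hC : ∀ᶠ i in l, ‖grad (u i)‖ ≤ C)
    (v : D.H1) :
    Tendsto (fun i => inner ℝ (grad (u i)) (grad v)) l (𝓝 (inner ℝ (grad W) (grad v))) := by
  rw [tendsto_iff_ultrafilter]
  intro g hg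
  obtain ⟨W', h1, h2⟩ := exists_weak_limit g u (hw.mono_left hg) C (hg hC)
  rw [← fn_injective h1]
  exact h2 v

theorem exists_weak_limit_norm_le {ι : Type*} (l : Ultrafilter ι) (u : ι → D.H1) {w : D.L2}
    (hw : Tendsto (fun i => fn (u i)) l (𝓝 w)) {C : ι → ℝ} {c : ℝ}
    (hC : ∀ᶠ i in l, ‖grad (u i)‖ ≤ C i) (hc : Tendsto C l (𝓝 c)) :
    ∃ W : D.H1, fn W = w ∧ ‖grad W‖ ≤ c := by
  have hb : ∀ᶠ i in l, ‖grad (u i)‖ ≤ c + 1 := by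
    filter_upwards [hC, hc.eventually (eventually_le_nhds (lt_add_one c))] with i h1 h2
    exact h1.trans h2
  obtain ⟨W, h1, h2⟩ := exists_weak_limit l u hw _ hb
  exact ⟨W, h1, norm_le_of_weak_limit (h2 W) hC hc⟩

end PCC.Domain

/-! ### Truncation in H¹ -/

namespace PCC

/-- Truncation of a real number to `[-c, c]`. -/
def clip (c z : ℝ) : ℝ := max (-c) (min c z)

theorem lipschitzWith_clip (c : ℝ) : LipschitzWith 1 (clip c) :=
  (LipschitzWith.id.const_min c).const_max (-c)

theorem continuous_clip (c : ℝ) : Continuous (clip c) := (lipschitzWith_clip c).continuous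

theorem abs_clip_sub_clip_le (c a b : ℝ) : |clip c a - clip c b| ≤ |a - b| := by
  simpa [Real.dist_eq] using (lipschitzWith_clip c).dist_le_mul a b

theorem abs_clip_le {c : ℝ} (hc : 0 ≤ c) (z : ℝ) : |clip c z| ≤ c := by
  rw [abs_le]
  exact ⟨le_max_left _ _, max_le (by linarith) (min_le_left _ _)⟩

theorem clip_of_abs_le {c z : ℝ} (hz : |z| ≤ c) : clip c z = z := by
  rw [abs_le] at hz
  rw [clip, min_eq_right hz.2, max_eq_right hz.1]

theorem clip_zero {c : ℝ} (hc : 0 ≤ c) : clip c 0 = 0 := clip_of_abs_le (by simpa)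

/-- Replacing each |y| by √(y² + e²) in this form yields `smoothClip`. -/
theorem clip_eq_abs {c : ℝ} (hc : 0 ≤ c) (z : ℝ) : clip c z = (|z + c| - |z - c|) / 2 := by
  rcases le_total z (-c) with h | h
  · rw [clip, min_eq_right (by linarith), max_eq_left h, abs_of_nonpos (by linarith),
      abs_of_nonpos (by linarith)]
    ring
  · rcases le_total z c with h' | h'
    · rw [clip_of_abs_le (abs_le.2 ⟨h, h'⟩), abs_of_nonneg (by linarith),
        abs_of_nonpos (by linarith)]
      ring
    · rw [clip, min_eq_left h', max_eq_right (by linarith), abs_of_nonneg (by linarith),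
        abs_of_nonneg (by linarith)]
      ring

/-- The variational inequality of the projection onto [-c, c]; it is the pointwise input of the weak
maximum principle. -/
theorem clip_variational {c g : ℝ} (hg : |g| ≤ c) (z : ℝ) :
    (z - clip c z) ^ 2 ≤ (z - g) * (z - clip c z) := by
  have hg' := abs_le.1 hg
  rcases le_total z (-c) with h | h
  · rw [clip, min_eq_right (by linarith), max_eq_left h]
    nlinarith
  · rcases le_total z c with h' | h'
    · rw [clip_of_abs_le (abs_le.2 ⟨h, h'⟩)]; simp
    · rw [clip, min_eq_left h', max_eq_right (by linarith)]
      nlinarith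

/-- A smooth approximation of `clip c`. -/
def smoothClip (c e z : ℝ) : ℝ := (√((z + c) ^ 2 + e ^ 2) - √((z - c) ^ 2 + e ^ 2)) / 2

theorem smoothClip_zero (c e : ℝ) : smoothClip c e 0 = 0 := by simp [smoothClip]

theorem contDiff_smoothClip (c : ℝ) {e : ℝ} (he : 0 < e) : ContDiff ℝ ∞ (smoothClip c e) := by
  unfold smoothClip
  refine ContDiff.div_const (ContDiff.sub ?_ ?_) 2
  · exact ContDiff.sqrt (by fun_prop) fun x => by positivity
  · exact ContDiff.sqrt (by fun_prop) fun x => by positivity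

theorem abs_div_sqrt_le_one (y e : ℝ) : |y / √(y ^ 2 + e ^ 2)| ≤ 1 := by
  rw [abs_div, abs_of_nonneg (Real.sqrt_nonneg _)]
  refine div_le_one_of_le₀ (Real.abs_le_sqrt ?_) (Real.sqrt_nonneg _)
  nlinarith [sq_nonneg e]

theorem abs_deriv_smoothClip_le (c : ℝ) {e : ℝ} (he : 0 < e) (z : ℝ) :
    |deriv (smoothClip c e) z| ≤ 1 := by
  have h : HasDerivAt (smoothClip c e)
      (((z + c) / √((z + c) ^ 2 + e ^ 2) - (z - c) / √((z - c) ^ 2 + e ^ 2)) / 2) z := by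
    unfold smoothClip
    have h1 : HasDerivAt (fun z => (z + c) ^ 2 + e ^ 2) (2 * (z + c)) z := by
      simpa using (((hasDerivAt_id z).add_const c).pow 2).add_const (e ^ 2)
    have h2 : HasDerivAt (fun z => (z - c) ^ 2 + e ^ 2) (2 * (z - c)) z := by
      simpa using (((hasDerivAt_id z).sub_const c).pow 2).add_const (e ^ 2)
    have := ((h1.sqrt (by positivity)).sub (h2.sqrt (by positivity))).div_const 2
    rwa [mul_div_mul_left _ _ two_ne_zero, mul_div_mul_left _ _ two_ne_zero] at this
  rw [h.deriv]
  have h1 := abs_le.1 (abs_div_sqrt_le_one (z + c) e)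
  have h2 := abs_le.1 (abs_div_sqrt_le_one (z - c) e)
  rw [abs_le]
  constructor <;> linarith [h1.1, h1.2, h2.1, h2.2]

theorem lipschitzWith_smoothClip (c : ℝ) {e : ℝ} (he : 0 < e) :
    LipschitzWith 1 (smoothClip c e) :=
  lipschitzWith_of_nnnorm_deriv_le ((contDiff_smoothClip c he).differentiable (by simp))
    fun z => by
      rw [← NNReal.coe_le_coe]
      simpa using abs_deriv_smoothClip_le c he z

theorem abs_smoothClip_sub_clip_le {c : ℝ} (hc : 0 ≤ c) {e : ℝ} (he : 0 < e) (z : ℝ) :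
    |smoothClip c e z - clip c z| ≤ e := by
  have key : ∀ y : ℝ, |y| ≤ √(y ^ 2 + e ^ 2) ∧ √(y ^ 2 + e ^ 2) ≤ |y| + e := fun y => by
    refine ⟨Real.abs_le_sqrt (by nlinarith [sq_nonneg e]), Real.sqrt_le_iff.2 ⟨by positivity, ?_⟩⟩
    nlinarith [sq_abs y, abs_nonneg y]
  rw [clip_eq_abs hc, smoothClip, abs_le]
  have h1 := key (z + c)
  have h2 := key (z - c)
  constructor <;> linarith [h1.1, h1.2, h2.1, h2.2]

namespace Domain

variable {d : ℕ} {D : Domain d}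

/-- Composition of a smooth pair with a smooth function of slope at most one. -/
theorem exists_comp_of_mem_smoothPairs {q : D.Pairs} (hq : q ∈ D.smoothPairs) {θ : ℝ → ℝ}
    (hθ : ContDiff ℝ ∞ θ) (h0 : θ 0 = 0) (hL : LipschitzWith 1 θ) (h1 : ∀ z, |deriv θ z| ≤ 1) :
    ∃ U : D.H1, fn U = hL.compLp h0 q.fst ∧ ‖grad U‖ ≤ ‖q.snd‖ := by
  obtain ⟨ψ, hψ, hf, hg⟩ := hq
  have hmeas : AEStronglyMeasurable (fun x => deriv θ (q.fst x) • q.snd x) D.vol :=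
    ((hθ.continuous_deriv (by simp)).comp_aestronglyMeasurable
      (Lp.aestronglyMeasurable q.fst)).smul (Lp.aestronglyMeasurable q.snd)
  have hle : ∀ x, ‖deriv θ (q.fst x) • q.snd x‖ ≤ ‖q.snd x‖ := fun x => by
    rw [norm_smul]
    exact mul_le_of_le_one_left (norm_nonneg _) (h1 _)
  have hmem : MemLp (fun x => deriv θ (q.fst x) • q.snd x) 2 D.vol :=
    (Lp.memLp q.snd).of_le hmeas (Eventually.of_forall hle)
  let U : D.Pairs := WithLp.toLp 2 (hL.compLp h0 q.fst, hmem.toLp)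
  have hU : U ∈ D.H1 := by
    rw [mem_H1_iff]
    refine subset_closure ⟨θ ∘ ψ, hψ.comp hθ h0, ?_, ?_⟩
    · filter_upwards [hL.coeFn_compLp h0 q.fst, hf] with x h1 h2
      change (hL.compLp h0 q.fst) x = _
      rw [h1, Function.comp_apply, h2, Function.comp_apply]
    · filter_upwards [hmem.coeFn_toLp, hf, hg, D.ae_mem_carrier] with x h1 h2 h3 hm
      change (hmem.toLp) x = _
      rw [h1, h2, h3, gradient_comp (hψ.differentiableAt hm) (hθ.differentiable (by simp) _)]
  refine ⟨⟨U, hU⟩, rfl, ?_⟩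
  change ‖hmem.toLp‖ ≤ _
  refine Lp.norm_le_norm_of_ae_le ?_
  filter_upwards [hmem.coeFn_toLp] with x hx
  rw [hx]
  exact hle x

/-- Pointwise truncation on `L²(Ω)`. -/
def clipLp (D : Domain d) {c : ℝ} (hc : 0 ≤ c) (u : D.L2) : D.L2 :=
  (lipschitzWith_clip c).compLp (clip_zero hc) u

theorem coeFn_clipLp {c : ℝ} (hc : 0 ≤ c) (u : D.L2) :
    ∀ᵐ x ∂D.vol, D.clipLp hc u x = clip c (u x) :=
  (lipschitzWith_clip c).coeFn_compLp (clip_zero hc) u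

theorem norm_clipLp_sub_le {c : ℝ} (hc : 0 ≤ c) (u v : D.L2) :
    ‖D.clipLp hc u - D.clipLp hc v‖ ≤ ‖u - v‖ :=
  ((lipschitzWith_clip c).norm_compLp_sub_le (clip_zero hc) u v).trans (by simp)

/-- Square root of the volume of the domain. -/
def sqrtVol (D : Domain d) : ℝ := (measureUnivNNReal D.vol : ℝ) ^ (2 : ℝ≥0∞).toReal⁻¹

theorem sqrtVol_nonneg (D : Domain d) : 0 ≤ D.sqrtVol := by unfold sqrtVol; positivity

theorem norm_le_of_ae_abs_le {u : D.L2} {C : ℝ} (hC : 0 ≤ C) (h : ∀ᵐ x ∂D.vol, |u x| ≤ C) :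
    ‖u‖ ≤ D.sqrtVol * C := by
  have := Lp.norm_le_of_ae_bound (f := u) hC h
  simpa [sqrtVol] using this

/-- Truncation maps `H¹` to itself and does not increase the norm of the gradient. -/
theorem exists_clip (u : D.H1) {c : ℝ} (hc : 0 ≤ c) :
    ∃ W : D.H1, fn W = D.clipLp hc (fn u) ∧ ‖grad W‖ ≤ ‖grad u‖ := by
  obtain ⟨q, hq, hqu⟩ := mem_closure_iff_seq_limit.1 (mem_H1_iff.1 u.2)
  have he : ∀ n : ℕ, (0 : ℝ) < 1 / ((n : ℝ) + 1) := fun n => by positivity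
  have h := fun n : ℕ => exists_comp_of_mem_smoothPairs (hq n) (contDiff_smoothClip c (he n))
    (smoothClip_zero _ _) (lipschitzWith_smoothClip c (he n)) (abs_deriv_smoothClip_le c (he n))
  choose U hU1 hU2 using h
  have hf : Tendsto (fun n => (q n).fst) atTop (𝓝 (fn u)) :=
    ((WithLp.fstL 2 ℝ D.L2 (Lp (Space d) 2 D.vol)).continuous.tendsto _).comp hqu
  have hg : Tendsto (fun n => (q n).snd) atTop (𝓝 (grad u)) :=
    ((WithLp.sndL 2 ℝ D.L2 (Lp (Space d) 2 D.vol)).continuous.tendsto _).comp hqu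
  -- The smooth truncations of the approximants converge strongly in L², while their gradients are
  -- only bounded; weak lower semicontinuity transfers the gradient bound to the limit.
  refine exists_weak_limit_norm_le (Filter.hyperfilter ℕ) U ?_
    (Eventually.of_forall hU2) (hg.norm.mono_left Nat.hyperfilter_le_atTop)
  refine Tendsto.mono_left ?_ Nat.hyperfilter_le_atTop
  rw [tendsto_iff_norm_sub_tendsto_zero] at hf ⊢
  have hlim : Tendsto (fun n : ℕ => D.sqrtVol * (1 / ((n : ℝ) + 1)) + ‖(q n).fst - fn u‖) atTop
      (𝓝 0) := by
    simpa using (tendsto_one_div_add_atTop_nhds_zero_nat.const_mul D.sqrtVol).add hf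
  refine squeeze_zero (fun n => norm_nonneg _) (fun n => ?_) hlim
  have h1 : ‖fn (U n) - D.clipLp hc (q n).fst‖ ≤ D.sqrtVol * (1 / ((n : ℝ) + 1)) := by
    refine norm_le_of_ae_abs_le (he n).le ?_
    filter_upwards [Lp.coeFn_sub (fn (U n)) (D.clipLp hc (q n).fst), coeFn_clipLp hc (q n).fst,
      (lipschitzWith_smoothClip c (he n)).coeFn_compLp (smoothClip_zero _ _) (q n).fst]
      with x hx h1 h2
    rw [hx, Pi.sub_apply, h1, hU1, h2, Function.comp_apply]
    exact abs_smoothClip_sub_clip_le hc (he n) _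
  calc ‖fn (U n) - D.clipLp hc (fn u)‖
      = ‖(fn (U n) - D.clipLp hc (q n).fst) +
          (D.clipLp hc (q n).fst - D.clipLp hc (fn u))‖ := by congr 1; abel
    _ ≤ _ := (norm_add_le _ _).trans (add_le_add h1 (norm_clipLp_sub_le hc _ _))

end Domain
end PCC

/-! ### The bound projection, the linear equation for fixed η, the maximum principle -/

namespace PCC

namespace Domain

variable {d : ℕ} {D : Domain d}

theorem deriv_p (β z : ℝ) : deriv (p β) z = -2 * z := by
  have h : HasDerivAt (p β) (-1 * (z - β) + -(z + β) * 1) z := by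
    unfold p
    exact (((hasDerivAt_id z).add_const β).neg).mul ((hasDerivAt_id z).sub_const β)
  rw [h.deriv]; ring

theorem maxBound_iff {β : ℝ} (hβ : 0 ≤ β) (u : D.L2) :
    D.MaxBound β u ↔ ∀ᵐ x ∂D.vol, |u x| ≤ β := by
  rw [MaxBound, eLpNorm_exponent_top]
  constructor
  · intro h
    filter_upwards [ae_le_eLpNormEssSup (f := u) (μ := D.vol)] with x hx
    have h1 := hx.trans h
    rwa [← ofReal_norm, ENNReal.ofReal_le_ofReal_iff hβ] at h1
  · intro h
    exact eLpNormEssSup_le_of_ae_bound (by simpa using h)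

/-- By complementarity, either the multiplier vanishes and w = u, or w = ±β and the sign of the
multiplier places u beyond that endpoint. -/
theorem isBoundProjection_iff {β : ℝ} (hβ : 0 < β) (u w : D.L2) :
    D.IsBoundProjection β u w ↔ w = D.clipLp hβ.le u := by
  constructor
  · rintro ⟨lam, h⟩
    refine Lp.ext ?_
    filter_upwards [h, coeFn_clipLp hβ.le u] with x hx hc
    rw [hc]
    obtain ⟨h1, h2, h3, h4⟩ := hx
    rw [deriv_p] at h1
    have hw : |w x| ≤ β := by
      rw [p] at h3
      refine abs_le_of_sq_le_sq (by nlinarith) hβ.le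
    rcases mul_eq_zero.1 h4 with h0 | h0
    · have : w x = u x := by rw [h0] at h1; linarith
      rw [← this, clip_of_abs_le hw]
    · rw [p] at h0
      rcases mul_eq_zero.1 h0 with h0 | h0
      · have hwx : w x = -β := by linarith
        rw [hwx] at h1 ⊢
        have : u x ≤ -β := by nlinarith [mul_nonneg h2 hβ.le]
        rw [clip, min_eq_right (by linarith), max_eq_left this]
      · have hwx : w x = β := by linarith
        rw [hwx] at h1 ⊢
        have : β ≤ u x := by nlinarith [mul_nonneg h2 hβ.le]
        rw [clip, min_eq_left this, max_eq_right (by linarith)]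
  · rintro rfl
    -- Outside the interval |w| = β, and w - u = -2 lam w forces this value.
    refine ⟨fun x => if |u x| ≤ β then 0 else (|u x| - β) / (2 * β), ?_⟩
    filter_upwards [coeFn_clipLp hβ.le u] with x hc
    rw [hc, deriv_p]
    split_ifs with h
    · rw [clip_of_abs_le h, p]
      have := abs_le.1 h
      exact ⟨by simp, le_rfl, by nlinarith [this.1, this.2], by simp⟩
    · rw [not_le] at h
      have h0 : 0 ≤ (|u x| - β) / (2 * β) := div_nonneg (by linarith) (by linarith)
      rcases le_total 0 (u x) with hu | hu
      · rw [abs_of_nonneg hu] at h h0 ⊢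
        rw [clip, min_eq_left h.le, max_eq_right (by linarith), p]
        refine ⟨by field_simp; ring, h0, by simp, by simp⟩
      · rw [abs_of_nonpos hu] at h h0 ⊢
        rw [clip, min_eq_right (by linarith), max_eq_left (by linarith), p]
        refine ⟨by field_simp; ring, h0, by simp, by simp⟩

theorem exists_bound_comp_clip {f : ℝ → ℝ} (hf : Continuous f) {c : ℝ} (hc : 0 ≤ c) :
    ∃ M, 0 ≤ M ∧ ∀ z, |z| ≤ c → |f z| ≤ M := by
  obtain ⟨M, hM⟩ := (isCompact_Icc (a := -c) (b := c)).exists_bound_of_continuousOn hf.continuousOn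
  refine ⟨M, (norm_nonneg _).trans (hM 0 ⟨by linarith, hc⟩), fun z hz => hM z (abs_le.1 hz)⟩

/-- Truncating the argument makes the composite bounded on a domain of finite volume, so f needs no
growth condition. -/
theorem memLp_comp_clip {f : ℝ → ℝ} (hf : Continuous f) {c : ℝ} (hc : 0 ≤ c) (w : D.L2) :
    MemLp (fun x => f (clip c (w x))) 2 D.vol := by
  obtain ⟨M, -, hM⟩ := exists_bound_comp_clip hf hc
  exact MemLp.of_bound ((hf.comp (continuous_clip c)).comp_aestronglyMeasurable
    (Lp.aestronglyMeasurable w)) M (Eventually.of_forall fun x => hM _ (abs_clip_le hc _))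

/-- The superposition operator `w ↦ f ∘ w` on functions bounded by `c`. -/
def superpos {f : ℝ → ℝ} (hf : Continuous f) {c : ℝ} (hc : 0 ≤ c) (w : D.L2) : D.L2 :=
  (memLp_comp_clip hf hc w).toLp

theorem coeFn_superpos {f : ℝ → ℝ} (hf : Continuous f) {c : ℝ} (hc : 0 ≤ c) {w : D.L2}
    (hw : ∀ᵐ x ∂D.vol, |w x| ≤ c) : ∀ᵐ x ∂D.vol, superpos hf hc w x = f (w x) := by
  filter_upwards [(memLp_comp_clip hf hc w).coeFn_toLp, hw] with x h1 h2
  rw [superpos, h1, clip_of_abs_le h2]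

theorem inner_L2 (u v : D.L2) : inner ℝ u v = ∫ x, u x * v x ∂D.vol := by
  rw [L2.inner_def]
  exact integral_congr_ae (Eventually.of_forall fun x => by simp [mul_comm])

theorem integrable_mul (u v : D.L2) : Integrable (fun x => u x * v x) D.vol :=
  (L2.integrable_inner (𝕜 := ℝ) u v).congr (Eventually.of_forall fun x => by simp [mul_comm])

/-- `ψ - w = -η (-Δψ + g)` weakly, with the boundary condition. -/
def Solves (g w : D.L2) (η : ℝ) (ψ : D.H1) : Prop :=
  ∀ v : D.H1, inner ℝ (fn ψ - w) (fn v) =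
    -η * (inner ℝ (grad ψ) (grad v) + inner ℝ g (fn v))

theorem eqn_iff_solves {f : ℝ → ℝ} (hf : Continuous f) {c : ℝ} (hc : 0 ≤ c) {w : D.L2}
    (hw : ∀ᵐ x ∂D.vol, |w x| ≤ c) (η : ℝ) (ψ : D.H1) :
    (∀ v : D.H1, ∫ x, (fn ψ x - w x) * fn v x ∂D.vol =
      -η * ((∫ x, inner ℝ (grad ψ x) (grad v x) ∂D.vol) + ∫ x, f (w x) * fn v x ∂D.vol)) ↔
    Solves (superpos hf hc w) w η ψ := by
  refine forall_congr' fun v => ?_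
  have h1 : inner ℝ (fn ψ - w) (fn v) = ∫ x, (fn ψ x - w x) * fn v x ∂D.vol := by
    rw [inner_L2]
    refine integral_congr_ae ?_
    filter_upwards [Lp.coeFn_sub (fn ψ) w] with x hx
    rw [hx, Pi.sub_apply]
  have h2 : inner ℝ (superpos hf hc w) (fn v) = ∫ x, f (w x) * fn v x ∂D.vol := by
    rw [inner_L2]
    refine integral_congr_ae ?_
    filter_upwards [coeFn_superpos hf hc hw] with x hx
    rw [hx]
  rw [h1, h2, L2.inner_def]

theorem isResidual_iff {f : ℝ → ℝ} (hf : Continuous f) {c : ℝ} (hc : 0 ≤ c) {φ : D.H1}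
    (hφ : ∀ᵐ x ∂D.vol, |fn φ x| ≤ c) (r : D.L2) :
    D.IsResidual f φ r ↔ ∀ v : D.H1,
      inner ℝ (grad φ) (grad v) + inner ℝ (superpos hf hc (fn φ)) (fn v) = inner ℝ r (fn v) := by
  refine forall_congr' fun v => ?_
  have h2 : inner ℝ (superpos hf hc (fn φ)) (fn v) = ∫ x, f (fn φ x) * fn v x ∂D.vol := by
    rw [inner_L2]
    refine integral_congr_ae ?_
    filter_upwards [coeFn_superpos hf hc hφ] with x hx
    rw [hx]
  rw [h2, L2.inner_def (𝕜 := ℝ) (grad φ), inner_L2]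

/-- The operator of the bilinear form `⟪u, v⟫ + η ⟪∇u, ∇v⟫`. -/
def formOp (D : Domain d) (η : ℝ) : D.H1 →L[ℝ] D.H1 :=
  (ContinuousLinearMap.adjoint D.fnL).comp D.fnL +
    (ContinuousLinearMap.adjoint D.gradL).comp (η • D.gradL)

theorem inner_formOp (η : ℝ) (u v : D.H1) : inner ℝ (D.formOp η u) v =
    inner ℝ (fn u) (fn v) + η * inner ℝ (grad u) (grad v) := by
  change inner ℝ (ContinuousLinearMap.adjoint D.fnL (D.fnL u) +
    ContinuousLinearMap.adjoint D.gradL (η • grad u)) v = _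
  rw [inner_add_left, ContinuousLinearMap.adjoint_inner_left,
    ContinuousLinearMap.adjoint_inner_left, real_inner_smul_left]
  rfl

theorem isCoercive_formOp {η : ℝ} (hη : 0 < η) :
    IsCoercive ((innerSL ℝ).comp (D.formOp η)) := by
  refine ⟨min 1 η, lt_min one_pos hη, fun u => ?_⟩
  rw [ContinuousLinearMap.comp_apply, innerSL_apply_apply, inner_formOp, mul_assoc, ← sq,
    norm_sq_eq, real_inner_self_eq_norm_sq, real_inner_self_eq_norm_sq]
  nlinarith [mul_le_mul_of_nonneg_right (min_le_left 1 η) (sq_nonneg ‖fn u‖),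
    mul_le_mul_of_nonneg_right (min_le_right 1 η) (sq_nonneg ‖grad u‖)]

theorem exists_formOp_eq {η : ℝ} (hη : 0 < η) (z : D.H1) : ∃ ψ, D.formOp η ψ = z := by
  let E := (isCoercive_formOp (D := D) hη).continuousLinearEquivOfBilin
  refine ⟨E.symm z, ext_inner_right ℝ fun v => ?_⟩
  have h1 := (isCoercive_formOp (D := D) hη).continuousLinearEquivOfBilin_apply (E.symm z) v
  rw [ContinuousLinearMap.comp_apply, innerSL_apply_apply] at h1
  rw [← h1]
  exact congrArg (inner ℝ · v) (E.apply_symm_apply z)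

/-- Lax-Milgram with coercivity constant min(1, η) covers η > 0. It degenerates at η = 0, where W
itself is the solution. -/
theorem exists_solves (g : D.L2) (W : D.H1) {η : ℝ} (hη : 0 ≤ η) :
    ∃ ψ, Solves g (fn W) η ψ := by
  rcases eq_or_lt_of_le hη with rfl | hη
  · exact ⟨W, fun v => by simp⟩
  obtain ⟨ψ, hψ⟩ := exists_formOp_eq hη (ContinuousLinearMap.adjoint D.fnL (fn W - η • g))
  refine ⟨ψ, fun v => ?_⟩
  have h1 := inner_formOp η ψ v
  rw [hψ, ContinuousLinearMap.adjoint_inner_left, fnL_apply, inner_sub_left,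
    real_inner_smul_left] at h1
  rw [inner_sub_left]
  linarith

/-- The equation satisfied by the difference of two solutions. -/
theorem Solves.sub {g w : D.L2} {η₁ η₂ : ℝ} {ψ₁ ψ₂ : D.H1} (h₁ : Solves g w η₁ ψ₁)
    (h₂ : Solves g w η₂ ψ₂) (v : D.H1) :
    inner ℝ (fn (ψ₂ - ψ₁)) (fn v) + η₁ * inner ℝ (grad (ψ₂ - ψ₁)) (grad v) =
      -(η₂ - η₁) * (inner ℝ (grad ψ₂) (grad v) + inner ℝ g (fn v)) := by
  have e1 := h₁ v
  have e2 := h₂ v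
  simp only [inner_sub_left, fn_sub, grad_sub] at *
  linarith

/-- At η = 0 only the L² part of the form survives, which is why injectivity of `fn` is needed. -/
theorem Solves.unique {g w : D.L2} {η : ℝ} (hη : 0 ≤ η) {ψ₁ ψ₂ : D.H1} (h₁ : Solves g w η ψ₁)
    (h₂ : Solves g w η ψ₂) : ψ₁ = ψ₂ := by
  have h := h₁.sub h₂ (ψ₂ - ψ₁)
  rw [real_inner_self_eq_norm_sq, real_inner_self_eq_norm_sq, sub_self, neg_zero, zero_mul] at h
  have h0 : ‖fn (ψ₂ - ψ₁)‖ ^ 2 = 0 := by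
    have := mul_nonneg hη (sq_nonneg ‖grad (ψ₂ - ψ₁)‖)
    have := sq_nonneg ‖fn (ψ₂ - ψ₁)‖
    linarith
  have h1 : fn (ψ₂ - ψ₁) = 0 := by simpa using h0
  rw [fn_sub, sub_eq_zero] at h1
  exact (fn_injective h1).symm

/-- Weak maximum principle. -/
theorem Solves.ae_abs_le {g w : D.L2} {η : ℝ} (hη : 0 ≤ η) {ψ : D.H1} (h : Solves g w η ψ) {c : ℝ}
    (hc : 0 ≤ c) (hb : ∀ᵐ x ∂D.vol, |w x - η * g x| ≤ c) : ∀ᵐ x ∂D.vol, |fn ψ x| ≤ c := by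
  -- Test with ψ minus its truncation: the gradient term is nonnegative because truncation does not
  -- increase the gradient norm.
  obtain ⟨W, hW, hle⟩ := exists_clip ψ hc
  have e := h (ψ - W)
  have h1 : 0 ≤ inner ℝ (grad ψ) (grad (ψ - W)) := by
    rw [grad_sub, inner_sub_right, real_inner_self_eq_norm_sq]
    nlinarith [real_inner_le_norm (grad ψ) (grad W), norm_nonneg (grad ψ)]
  have h2 : ‖fn (ψ - W)‖ ^ 2 ≤ inner ℝ (fn ψ - (w - η • g)) (fn (ψ - W)) := by
    rw [← real_inner_self_eq_norm_sq, inner_L2, inner_L2]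
    refine integral_mono_ae (integrable_mul _ _) (integrable_mul _ _) ?_
    filter_upwards [hb, coeFn_clipLp hc (fn ψ), Lp.coeFn_sub (fn ψ) (fn W),
      Lp.coeFn_sub (fn ψ) (w - η • g), Lp.coeFn_sub w (η • g), Lp.coeFn_smul η g]
      with x hb h1 h2 h3 h4 h5
    simp only [fn_sub]
    rw [h2, h3, Pi.sub_apply, Pi.sub_apply, h4, Pi.sub_apply, h5, Pi.smul_apply, hW, h1, ← sq]
    exact clip_variational hb _
  have h3 : inner ℝ (fn ψ - (w - η • g)) (fn (ψ - W)) ≤ 0 := by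
    have : fn ψ - (w - η • g) = (fn ψ - w) + η • g := by abel
    rw [this, inner_add_left, real_inner_smul_left, e]
    nlinarith
  have h4 : fn (ψ - W) = 0 := by
    have : ‖fn (ψ - W)‖ ^ 2 = 0 := le_antisymm (h2.trans h3) (sq_nonneg _)
    simpa using this
  rw [fn_sub, sub_eq_zero, hW] at h4
  filter_upwards [coeFn_clipLp hc (fn ψ)] with x hx
  rw [h4, hx]
  exact abs_clip_le hc _

end Domain
end PCC

/-! ### Superposition operators and a priori estimates -/

namespace PCC

/-- A continuous function on a compact interval is Lipschitz up to an arbitrarily small error. -/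
theorem exists_abs_sub_le_add_mul {f : ℝ → ℝ} (hf : Continuous f) (c : ℝ) {κ : ℝ} (hκ : 0 < κ) :
    ∃ C, 0 ≤ C ∧ ∀ a b, |a| ≤ c → |b| ≤ c → |f a - f b| ≤ κ + C * |a - b| := by
  obtain ⟨M, hM⟩ := (isCompact_Icc (a := -c) (b := c)).exists_bound_of_continuousOn hf.continuousOn
  have hu := (isCompact_Icc (a := -c) (b := c)).uniformContinuousOn_of_continuous hf.continuousOn
  obtain ⟨ρ, hρ, h⟩ := Metric.uniformContinuousOn_iff.1 hu κ hκ
  -- Below distance ρ uniform continuity gives κ; beyond it, the crude bound 2|M| is at most C|a -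
  -- b|.
  refine ⟨2 * |M| / ρ, by positivity, fun a b ha hb => ?_⟩
  have ha' : a ∈ Set.Icc (-c) c := abs_le.1 ha
  have hb' : b ∈ Set.Icc (-c) c := abs_le.1 hb
  rcases lt_or_ge |a - b| ρ with hab | hab
  · have h1 := h a ha' b hb' hab
    rw [Real.dist_eq] at h1
    have : 0 ≤ 2 * |M| / ρ * |a - b| := by positivity
    linarith
  · have h1 : |f a - f b| ≤ |M| + |M| := by
      refine (abs_sub _ _).trans (add_le_add ?_ ?_)
      · exact (hM a ha').trans (le_abs_self M)
      · exact (hM b hb').trans (le_abs_self M)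
    have h2 : 2 * |M| / ρ * ρ ≤ 2 * |M| / ρ * |a - b| := by gcongr
    rw [div_mul_cancel₀ _ hρ.ne'] at h2
    linarith

namespace Domain

variable {d : ℕ} {D : Domain d}

theorem norm_le_add_of_ae_abs_le {u v : D.L2} {κ C : ℝ} (hκ : 0 ≤ κ) (hC : 0 ≤ C)
    (h : ∀ᵐ x ∂D.vol, |u x| ≤ κ + C * |v x|) : ‖u‖ ≤ D.sqrtVol * κ + C * ‖v‖ := by
  have hk : MemLp (fun _ : Space d => κ) 2 D.vol := memLp_const κ
  have h1 : ‖hk.toLp‖ ≤ D.sqrtVol * κ := by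
    refine norm_le_of_ae_abs_le hκ ?_
    filter_upwards [hk.coeFn_toLp] with x hx
    rw [hx, abs_of_nonneg hκ]
  have h2 : ‖u‖ ≤ ‖hk.toLp + C • |v|‖ := by
    refine Lp.norm_le_norm_of_ae_le ?_
    filter_upwards [h, hk.coeFn_toLp, Lp.coeFn_add hk.toLp (C • |v|), Lp.coeFn_smul C |v|,
      Lp.coeFn_abs v] with x h h1 h2 h3 h4
    rw [h2, Pi.add_apply, h1, h3, Pi.smul_apply, h4, smul_eq_mul, Real.norm_eq_abs, Real.norm_eq_abs]
    exact h.trans (le_abs_self _)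
  refine h2.trans ((norm_add_le _ _).trans (add_le_add h1 ?_))
  rw [norm_smul, norm_abs_eq_norm, Real.norm_of_nonneg hC]

theorem norm_superpos_le {f : ℝ → ℝ} (hf : Continuous f) {c : ℝ} (hc : 0 ≤ c) {M : ℝ} (hM : 0 ≤ M)
    (h : ∀ z, |z| ≤ c → |f z| ≤ M) (w : D.L2) : ‖superpos hf hc w‖ ≤ D.sqrtVol * M := by
  refine norm_le_of_ae_abs_le hM ?_
  filter_upwards [(memLp_comp_clip hf hc w).coeFn_toLp] with x hx
  rw [superpos, hx]
  exact h _ (abs_clip_le hc _)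

theorem continuous_superpos {f : ℝ → ℝ} (hf : Continuous f) {c : ℝ} (hc : 0 ≤ c) :
    Continuous (superpos (D := D) hf hc) := by
  rw [Metric.continuous_iff]
  intro w e he
  have hV := D.sqrtVol_nonneg
  obtain ⟨C, hC, h⟩ := exists_abs_sub_le_add_mul hf c (κ := e / (2 * (D.sqrtVol + 1)))
    (by positivity)
  refine ⟨e / (2 * (C + 1)), by positivity, fun u hu => ?_⟩
  rw [dist_eq_norm] at hu ⊢
  have h1 : ‖superpos hf hc u - superpos hf hc w‖ ≤
      D.sqrtVol * (e / (2 * (D.sqrtVol + 1))) + C * ‖u - w‖ := by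
    refine norm_le_add_of_ae_abs_le (by positivity) hC ?_
    filter_upwards [(memLp_comp_clip hf hc u).coeFn_toLp, (memLp_comp_clip hf hc w).coeFn_toLp,
      Lp.coeFn_sub (superpos hf hc u) (superpos hf hc w), Lp.coeFn_sub u w] with x h1 h2 h3 h4
    rw [h3, Pi.sub_apply, h4, Pi.sub_apply, superpos, superpos, h1, h2]
    refine (h _ _ (abs_clip_le hc _) (abs_clip_le hc _)).trans ?_
    gcongr _ + C * ?_
    exact abs_clip_sub_clip_le c _ _
  have h2 : D.sqrtVol * (e / (2 * (D.sqrtVol + 1))) ≤ e / 2 := by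
    rw [mul_div_assoc', div_le_div_iff₀ (by positivity) (by positivity)]
    nlinarith
  have h3 : C * ‖u - w‖ < e / 2 := by
    have h4 : (C + 1) * ‖u - w‖ < (C + 1) * (e / (2 * (C + 1))) := by gcongr
    have h5 : (C + 1) * (e / (2 * (C + 1))) = e / 2 := by field_simp
    nlinarith [norm_nonneg (u - w)]
  linarith

/-- Test with ψ - W and absorb by Young's inequality: the L² displacement is of order √η, uniformly
for bounded data. -/
theorem Solves.norm_fn_sub_le {g : D.L2} {W : D.H1} {η : ℝ} (hη : 0 ≤ η) (hη1 : η ≤ 1) {ψ : D.H1}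
    (h : Solves g (fn W) η ψ) : ‖fn ψ - fn W‖ ≤ √(η * (‖grad W‖ ^ 2 + ‖g‖ ^ 2)) := by
  refine Real.le_sqrt_of_sq_le ?_
  have e := h (ψ - W)
  rw [fn_sub, grad_sub, real_inner_self_eq_norm_sq, inner_sub_right, real_inner_self_eq_norm_sq] at e
  have h1 := real_inner_le_norm (grad ψ) (grad W)
  have h2 := neg_le_of_abs_le (abs_real_inner_le_norm g (fn ψ - fn W))
  set x := ‖fn ψ - fn W‖
  have h3 : -(‖grad W‖ ^ 2 / 4) ≤ ‖grad ψ‖ ^ 2 - inner ℝ (grad ψ) (grad W) := by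
    nlinarith [sq_nonneg (‖grad ψ‖ - ‖grad W‖ / 2)]
  have h4 : x ^ 2 ≤ η * (‖grad W‖ ^ 2 / 4 + ‖g‖ * x) := by
    rw [e, neg_mul, ← mul_neg]
    exact mul_le_mul_of_nonneg_left (by linarith) hη
  have h5 : η ^ 2 * ‖g‖ ^ 2 ≤ η * ‖g‖ ^ 2 := by
    refine mul_le_mul_of_nonneg_right ?_ (sq_nonneg _)
    nlinarith
  nlinarith [sq_nonneg (x - η * ‖g‖), mul_nonneg hη (sq_nonneg ‖grad W‖)]

/-- Testing with ψ - W and dividing by η gives ‖∇ψ‖² ≤ ⟪∇ψ, ∇W⟫ + ‖g‖‖ψ - W‖. The additive 1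
replaces a square root, since a larger gradient would have norm above 1. -/
theorem Solves.norm_grad_le {g : D.L2} {W : D.H1} {η : ℝ} (hη : 0 ≤ η) {ψ : D.H1}
    (h : Solves g (fn W) η ψ) : ‖grad ψ‖ ≤ ‖grad W‖ + ‖g‖ * ‖fn ψ - fn W‖ + 1 := by
  have hy : 0 ≤ ‖g‖ * ‖fn ψ - fn W‖ := by positivity
  rcases eq_or_lt_of_le hη with rfl | hη
  · have : ψ = W := h.unique le_rfl fun v => by simp
    subst this
    linarith
  have e := h (ψ - W)
  rw [fn_sub, grad_sub, real_inner_self_eq_norm_sq, inner_sub_right, real_inner_self_eq_norm_sq] at e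
  have h1 := real_inner_le_norm (grad ψ) (grad W)
  have h2 := neg_le_of_abs_le (abs_real_inner_le_norm g (fn ψ - fn W))
  have h3 : ‖grad ψ‖ ^ 2 - inner ℝ (grad ψ) (grad W) + inner ℝ g (fn ψ - fn W) ≤ 0 := by
    by_contra! h0
    have := mul_pos hη h0
    nlinarith [sq_nonneg ‖fn ψ - fn W‖]
  by_contra! hlt
  have h4 := mul_lt_mul_of_pos_left hlt
    (show 0 < ‖grad ψ‖ by linarith [norm_nonneg (grad W)])
  nlinarith [norm_nonneg (grad W)]

/-- The residual of ψ₂ is (W - ψ₂)/η₂, so the increment is a resolvent applied to a multiple of W -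
ψ₂, and the resolvent contracts the gradient seminorm. This controls η₁ times the gradient of the
difference quotient. -/
theorem Solves.mul_norm_grad_sub_le {g : D.L2} {W : D.H1} {η₁ η₂ : ℝ} (hη : 0 ≤ η₁) (hlt : η₁ < η₂)
    {ψ₁ ψ₂ : D.H1} (h₁ : Solves g (fn W) η₁ ψ₁) (h₂ : Solves g (fn W) η₂ ψ₂) :
    η₁ * ‖grad (ψ₂ - ψ₁)‖ ≤ (η₂ - η₁) * ‖grad (W - ψ₂)‖ := by
  rcases eq_or_lt_of_le hη with rfl | hη
  · rw [zero_mul]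
    exact mul_nonneg (by linarith) (norm_nonneg _)
  set u := W - ψ₂ with hu
  set δ := ψ₂ - ψ₁ with hδ
  set t := η₂ - η₁ with ht
  have hη2 : 0 < η₂ := hη.trans hlt
  have e : ∀ v : D.H1, η₂ * inner ℝ (fn δ) (fn v) + η₂ * η₁ * inner ℝ (grad δ) (grad v) =
      - t * inner ℝ (fn u) (fn v) := by
    intro v
    have e1 := h₁.sub h₂ v
    have e2 := h₂ v
    have e3 : inner ℝ (fn u) (fn v) = - inner ℝ (fn ψ₂ - fn W) (fn v) := by
      rw [hu, fn_sub, ← inner_neg_left, neg_sub]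
    rw [e3, e2, ht]
    linear_combination η₂ * e1
  -- With this test function the L² terms form a perfect square and can be dropped.
  have e1 := e (η₂ • δ + t • u)
  have e2 : 0 ≤ ‖fn (η₂ • δ + t • u)‖ ^ 2 := sq_nonneg _
  rw [← real_inner_self_eq_norm_sq] at e2
  simp only [fn_add, fn_smul, grad_add, grad_smul, inner_add_left, inner_add_right,
    real_inner_smul_left, real_inner_smul_right, real_inner_self_eq_norm_sq, norm_smul, mul_pow,
    Real.norm_eq_abs, sq_abs] at e1 e2
  rw [real_inner_comm (fn δ) (fn u)] at e1 e2
  have e3 : η₁ * (η₂ * ‖grad δ‖) * (η₂ * ‖grad δ‖ - t * ‖grad u‖) ≤ 0 := by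
    have h3 : η₂ * η₁ * t * (-inner ℝ (grad δ) (grad u)) ≤
        η₂ * η₁ * t * (‖grad δ‖ * ‖grad u‖) := by
      refine mul_le_mul_of_nonneg_left ?_ (by rw [ht]; have := sub_pos.2 hlt; positivity)
      have := neg_le_of_abs_le (abs_real_inner_le_norm (grad δ) (grad u))
      linarith
    nlinarith
  have h5 : η₂ * ‖grad δ‖ ≤ t * ‖grad u‖ := by
    by_contra! h0
    have hpos : 0 ≤ t * ‖grad u‖ := mul_nonneg (sub_pos.2 hlt).le (norm_nonneg _)
    have := mul_pos (mul_pos hη (hpos.trans_lt h0)) (sub_pos.2 h0)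
    linarith
  exact (mul_le_mul_of_nonneg_right hlt.le (norm_nonneg _)).trans h5

end Domain
end PCC

/-! ### Lower bound on the speed, by compactness -/

namespace PCC
namespace Domain

variable {d : ℕ} {D : Domain d}

/-- Along a compact set of unsteady states, the states reached from a nearby intermediate state
move at a speed bounded below. -/
theorem exists_speed_lower_bound {f : ℝ → ℝ} (hf : Continuous f) {β : ℝ} (hβ : 0 ≤ β)
    {K : Set D.H1} (hK : IsCompact K) (hbound : ∀ φ ∈ K, ∀ᵐ x ∂D.vol, |fn φ x| ≤ β)
    {ε : ℝ} (hε : 0 < ε) (hun : ∀ φ ∈ K, D.Unsteady f ε φ) :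
    ∃ ρ, 0 < ρ ∧ ∀ φ ∈ K, ∀ W : D.H1, ‖fn W - fn φ‖ ≤ ρ →
      ‖grad W‖ ≤ ‖grad φ‖ + 1 → ∀ η₁ η₂ : ℝ, 0 ≤ η₁ → η₁ < η₂ → η₂ ≤ ρ → ∀ ψ₁ ψ₂ : D.H1,
      Solves (superpos hf hβ (fn W)) (fn W) η₁ ψ₁ → Solves (superpos hf hβ (fn W)) (fn W) η₂ ψ₂ →
      √ε / 2 * (η₂ - η₁) ≤ ‖fn ψ₂ - fn ψ₁‖ := by
  by_contra! hcon
  have he : ∀ n : ℕ, (0 : ℝ) < 1 / ((n : ℝ) + 1) := fun n => by positivity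
  have hcon' := fun n : ℕ => hcon _ (he n)
  choose φ hφK W hWφ hWg η₁ η₂ h0 hlt hη₂ ψ₁ ψ₂ hs₁ hs₂ hsmall using hcon'
  have he0 : Tendsto (fun n : ℕ => 1 / ((n : ℝ) + 1)) (hyperfilter ℕ : Filter ℕ) (𝓝 0) :=
    tendsto_one_div_add_atTop_nhds_zero_nat.mono_left Nat.hyperfilter_le_atTop
  obtain ⟨φ₀, hφ₀, hlim⟩ := isCompact_iff_ultrafilter_le_nhds.1 hK ((hyperfilter ℕ).map φ)
    (by
      rw [Ultrafilter.coe_map, le_principal_iff]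
      exact mem_map.2 (univ_mem' hφK))
  have hlim' : Tendsto φ (hyperfilter ℕ : Filter ℕ) (𝓝 φ₀) := hlim
  obtain ⟨G, hG⟩ := hK.isBounded.exists_norm_le
  obtain ⟨M, hM, hfM⟩ := exists_bound_comp_clip hf hβ
  set g : ℕ → D.L2 := fun n => superpos hf hβ (fn (W n)) with hg
  have hgM : ∀ n, ‖g n‖ ≤ D.sqrtVol * M := fun n => norm_superpos_le hf hβ hM hfM _
  have hWG : ∀ n, ‖grad (W n)‖ ≤ G + 1 := fun n =>
    (hWg n).trans (by linarith [(norm_grad_le (φ n)).trans (hG _ (hφK n))])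
  have hη₁ : ∀ n, η₂ n ≤ 1 := fun n => (hη₂ n).trans (by
    rw [div_le_one (by positivity)]
    linarith [(Nat.cast_nonneg n : (0 : ℝ) ≤ n)])
  have hη0 : ∀ n, 0 ≤ η₂ n := fun n => (h0 n).trans (hlt n).le
  -- Strong L² convergence comes from compactness of K, not from a compact embedding, so no boundary
  -- regularity is required.
  have hW : Tendsto (fun n => fn (W n)) (hyperfilter ℕ : Filter ℕ) (𝓝 (fn φ₀)) := by
    have h1 : Tendsto (fun n => fn (W n) - fn (φ n)) (hyperfilter ℕ : Filter ℕ) (𝓝 0) :=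
      squeeze_zero_norm hWφ he0
    simpa using h1.add ((continuous_fn.tendsto _).comp hlim')
  have hdist : ∀ n, ‖fn (ψ₂ n) - fn (W n)‖ ≤
      √(1 / ((n : ℝ) + 1) * ((G + 1) ^ 2 + (D.sqrtVol * M) ^ 2)) := fun n => by
    refine ((hs₂ n).norm_fn_sub_le (hη0 n) (hη₁ n)).trans (Real.sqrt_le_sqrt ?_)
    have := hWG n
    have := hgM n
    have := hη₂ n
    gcongr
  have hdist0 : Tendsto (fun n : ℕ => √(1 / ((n : ℝ) + 1) * ((G + 1) ^ 2 + (D.sqrtVol * M) ^ 2)))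
      (hyperfilter ℕ : Filter ℕ) (𝓝 0) := by
    simpa using (he0.mul_const ((G + 1) ^ 2 + (D.sqrtVol * M) ^ 2)).sqrt
  have hψ : Tendsto (fun n => fn (ψ₂ n)) (hyperfilter ℕ : Filter ℕ) (𝓝 (fn φ₀)) := by
    simpa using (squeeze_zero_norm hdist hdist0).add hW
  have hψb : ∀ᶠ n in (hyperfilter ℕ : Filter ℕ),
      ‖grad (ψ₂ n)‖ ≤ (G + 1) + D.sqrtVol * M * 1 + 1 := by
    filter_upwards [hdist0.eventually (eventually_le_nhds one_pos)] with n hn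
    refine ((hs₂ n).norm_grad_le (hη0 n)).trans ?_
    have h1 := hWG n
    have h2 := hgM n
    have h3 := (hdist n).trans hn
    have hV := D.sqrtVol_nonneg
    gcongr
  set s : ℕ → D.H1 := fun n => (η₂ n - η₁ n)⁻¹ • (ψ₁ n - ψ₂ n) with hsdef
  have hsn : ∀ n, ‖fn (s n)‖ ≤ √ε / 2 := fun n => by
    have hpos := sub_pos.2 (hlt n)
    rw [hsdef, fn_smul, fn_sub, norm_smul, norm_inv, Real.norm_of_nonneg hpos.le, norm_sub_rev,
      inv_mul_le_iff₀ hpos, mul_comm]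
    exact (hsmall n).le
  -- η₁ s tends to 0 in L² and has bounded gradients, so the gradient term of the quotient equation
  -- vanishes weakly although ∇s need not be bounded.
  set t : ℕ → D.H1 := fun n => η₁ n • s n with htdef
  have ht0 : Tendsto (fun n => fn (t n)) (hyperfilter ℕ : Filter ℕ) (𝓝 (fn (0 : D.H1))) := by
    rw [fn_zero]
    refine squeeze_zero_norm (a := fun n : ℕ => 1 / ((n : ℝ) + 1) * (√ε / 2)) (fun n => ?_) ?_
    · rw [htdef, fn_smul, norm_smul, Real.norm_of_nonneg (h0 n)]
      have h1 := hsn n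
      have h2 := (hlt n).le.trans (hη₂ n)
      gcongr
    · simpa using he0.mul_const (√ε / 2)
  have htb : ∀ᶠ n in (hyperfilter ℕ : Filter ℕ),
      ‖grad (t n)‖ ≤ (G + 1) + ((G + 1) + D.sqrtVol * M * 1 + 1) := by
    filter_upwards [hψb] with n hn
    have hpos := sub_pos.2 (hlt n)
    have h1 := (hs₁ n).mul_norm_grad_sub_le (h0 n) (hlt n) (hs₂ n)
    rw [htdef, hsdef, grad_smul, grad_smul, norm_smul, norm_smul, norm_inv,
      Real.norm_of_nonneg hpos.le, Real.norm_of_nonneg (h0 n), grad_sub, norm_sub_rev, ← grad_sub,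
      mul_left_comm, inv_mul_le_iff₀ hpos]
    refine h1.trans (mul_le_mul_of_nonneg_left ?_ hpos.le)
    rw [grad_sub]
    exact (norm_sub_le _ _).trans (add_le_add (hWG n) hn)
  obtain ⟨r, hr⟩ := exists_weak_limit_of_bounded (hyperfilter ℕ) (fun n => fn (s n)) _
    (Eventually.of_forall hsn)
  have hrn : ‖r‖ ≤ √ε / 2 :=
    norm_le_of_weak_limit (hr r) (Eventually.of_forall hsn) tendsto_const_nhds
  -- Passing to the limit in the difference equation divided by η₂ - η₁ identifies r as the residual
  -- of φ₀.
  have hres : D.IsResidual f φ₀ r := by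
    rw [isResidual_iff hf hβ (hbound _ hφ₀)]
    intro v
    have e : ∀ n, inner ℝ (grad (ψ₂ n)) (grad v) + inner ℝ (g n) (fn v) =
        inner ℝ (fn (s n)) (fn v) + inner ℝ (grad (t n)) (grad v) := by
      intro n
      have hpos := sub_pos.2 (hlt n)
      have h1 := (hs₁ n).sub (hs₂ n) v
      rw [htdef, hsdef]
      simp only [fn_smul, grad_smul, fn_sub, grad_sub, inner_sub_left, real_inner_smul_left] at h1 ⊢
      field_simp
      linear_combination h1
    have l1 := (tendsto_inner_grad hψ _ hψb v).add
      ((((continuous_superpos hf hβ).tendsto _).comp hW).inner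
        (tendsto_const_nhds (x := fn v)))
    have l2 := (hr (fn v)).add (tendsto_inner_grad ht0 _ htb v)
    rw [grad_zero, inner_zero_left, add_zero] at l2
    refine tendsto_nhds_unique l1 (l2.congr fun n => ?_)
    exact (e n).symm
  have h1 := hun _ hφ₀ r hres
  have h2 : ‖r‖ ^ 2 ≤ (√ε / 2) ^ 2 := by gcongr
  rw [div_pow, Real.sq_sqrt hε.le] at h2
  linarith

end Domain
end PCC

/-! ### Energy change and continuity in the multiplier -/

namespace PCC

/-- Mean value inequality for y ↦ F y - f z * y on the segment from a to b. Here z stands for the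
intermediate state, at which the scheme evaluates f. -/
theorem abs_primitive_sub_le {F f : ℝ → ℝ} (hF : ∀ z, HasDerivAt F (f z) z) {B κ C : ℝ}
    (hC : 0 ≤ C) (h : ∀ a b, |a| ≤ B → |b| ≤ B → |f a - f b| ≤ κ + C * |a - b|) {a b z : ℝ}
    (ha : |a| ≤ B) (hb : |b| ≤ B) (hz : |z| ≤ B) :
    |F b - F a - f z * (b - a)| ≤ (κ + C * |a - z| + C * |b - z|) * |b - a| := by
  have hd : ∀ x ∈ Set.uIcc a b,
      HasDerivWithinAt (fun y => F y - f z * y) (f x - f z * 1) (Set.uIcc a b) x :=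
    fun x _ => ((hF x).sub ((hasDerivAt_id x).const_mul (f z))).hasDerivWithinAt
  have hbd : ∀ x ∈ Set.uIcc a b, ‖f x - f z * 1‖ ≤ κ + C * |a - z| + C * |b - z| := by
    intro x hx
    rw [mul_one, Real.norm_eq_abs]
    have hx' : |x| ≤ B ∧ |x - z| ≤ |a - z| + |b - z| := by
      rw [abs_le] at ha hb ⊢
      have h1 := abs_le.1 (le_refl |a - z|)
      have h2 := abs_le.1 (le_refl |b - z|)
      have h3 := abs_nonneg (a - z)
      have h4 := abs_nonneg (b - z)
      rw [abs_le]
      rcases Set.mem_uIcc.1 hx with ⟨h5, h6⟩ | ⟨h5, h6⟩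
      · exact ⟨⟨by linarith, by linarith⟩, by linarith, by linarith⟩
      · exact ⟨⟨by linarith, by linarith⟩, by linarith, by linarith⟩
    have := mul_le_mul_of_nonneg_left hx'.2 hC
    linarith [h x z hx'.1 hz]
  have key := (convex_uIcc a b).norm_image_sub_le_of_norm_hasDerivWithin_le hd hbd
    Set.left_mem_uIcc Set.right_mem_uIcc
  rw [Real.norm_eq_abs, Real.norm_eq_abs] at key
  convert key using 2
  ring

theorem abs_primitive_sub_le_of_bound {F f : ℝ → ℝ} (hF : ∀ z, HasDerivAt F (f z) z) {B M : ℝ}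
    (hM : ∀ z, |z| ≤ B → |f z| ≤ M) {a b : ℝ} (ha : |a| ≤ B) (hb : |b| ≤ B) :
    |F b - F a| ≤ M * |b - a| := by
  have hconv : Convex ℝ (Set.Icc (-B) B) := convex_Icc _ _
  exact hconv.norm_image_sub_le_of_norm_hasDerivWithin_le
    (fun x _ => (hF x).hasDerivWithinAt) (fun x hx => hM x (abs_le.2 hx)) (abs_le.1 ha) (abs_le.1 hb)

/-- Under the sign condition, an explicit step preserves the maximum bound for small step sizes. -/
theorem SignCondition.exists_step {f : ℝ → ℝ} {β : ℝ} (hβ : 0 ≤ β) (h : SignCondition f β) :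
    ∃ L, 0 ≤ L ∧ ∀ η z : ℝ, 0 ≤ η → η * L ≤ 1 → |z| ≤ β → |z - η * f z| ≤ β := by
  obtain ⟨L, hL⟩ := (isCompact_Icc (a := -β) (b := β)).exists_bound_of_continuousOn
    (h.1.continuous_deriv le_rfl).continuousOn
  have hL0 : 0 ≤ L := (norm_nonneg _).trans (hL 0 ⟨by linarith, hβ⟩)
  have hlip : ∀ a ∈ Set.Icc (-β) β, ∀ b ∈ Set.Icc (-β) β, |f b - f a| ≤ L * |b - a| :=
    fun a ha b hb => (convex_Icc (-β) β).norm_image_sub_le_of_norm_deriv_le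
      (fun x _ => h.1.differentiable (by simp) x) hL ha hb
  refine ⟨L, hL0, fun η z hη hηL hz => ?_⟩
  have hz' := abs_le.1 hz
  -- Comparison with the endpoints, where f(β) ≥ 0 and f(-β) ≤ 0, gives -L(β - z) ≤ f(z) ≤ L(z + β).
  have h1 := hlip β ⟨by linarith, le_rfl⟩ z hz'
  have h2 := hlip (-β) ⟨le_rfl, by linarith⟩ z hz'
  rw [abs_of_nonpos (a := z - β) (by linarith)] at h1
  rw [abs_of_nonneg (a := z - -β) (by linarith)] at h2
  have h3 := (abs_le.1 h1).1
  have h4 := (abs_le.1 h2).2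
  have h5 := h.2.1 (-β) le_rfl
  have h6 := h.2.2 β le_rfl
  have h7 : -(L * (β - z)) ≤ f z := by linarith
  have h8 : f z ≤ L * (z + β) := by linarith
  have h9 := mul_le_mul_of_nonneg_left h7 hη
  have h10 := mul_le_mul_of_nonneg_left h8 hη
  have h11 := mul_le_mul_of_nonneg_right hηL (show 0 ≤ β - z by linarith)
  have h12 := mul_le_mul_of_nonneg_right hηL (show 0 ≤ z + β by linarith)
  rw [abs_le]
  constructor <;> nlinarith

namespace Domain

variable {d : ℕ} {D : Domain d}

theorem abs_integral_le {Z : Space d → ℝ} {a b δ : D.L2} {κ C : ℝ} (hκ : 0 ≤ κ) (hC : 0 ≤ C)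
    (h : ∀ᵐ x ∂D.vol, |Z x| ≤ (κ + C * |a x| + C * |b x|) * |δ x|) :
    |∫ x, Z x ∂D.vol| ≤ (D.sqrtVol * κ + C * ‖a‖ + C * ‖b‖) * ‖δ‖ := by
  have hk : MemLp (fun _ : Space d => κ) 2 D.vol := memLp_const κ
  have h1 : ‖hk.toLp‖ ≤ D.sqrtVol * κ := by
    refine norm_le_of_ae_abs_le hκ ?_
    filter_upwards [hk.coeFn_toLp] with x hx
    rw [hx, abs_of_nonneg hκ]
  set H : D.L2 := hk.toLp + C • |a| + C • |b| with hH
  have h2 : |∫ x, Z x ∂D.vol| ≤ inner ℝ H |δ| := by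
    rw [inner_L2, ← Real.norm_eq_abs]
    refine norm_integral_le_of_norm_le (integrable_mul _ _) ?_
    filter_upwards [h, hk.coeFn_toLp, Lp.coeFn_add (hk.toLp + C • |a|) (C • |b|),
      Lp.coeFn_add hk.toLp (C • |a|), Lp.coeFn_smul C |a|, Lp.coeFn_smul C |b|,
      Lp.coeFn_abs a, Lp.coeFn_abs b, Lp.coeFn_abs δ] with x h h1 h2 h3 h4 h5 h6 h7 h8
    rw [hH, h2, Pi.add_apply, h3, Pi.add_apply, h1, h4, h5, Pi.smul_apply, Pi.smul_apply, h6, h7, h8]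
    exact h
  have h3 : ‖H‖ ≤ D.sqrtVol * κ + C * ‖a‖ + C * ‖b‖ := by
    refine (norm_add₃_le).trans ?_
    rw [norm_smul, norm_smul, norm_abs_eq_norm, norm_abs_eq_norm, Real.norm_of_nonneg hC]
    gcongr
  calc |∫ x, Z x ∂D.vol| ≤ ‖H‖ * ‖|δ|‖ := h2.trans (real_inner_le_norm _ _)
    _ = ‖H‖ * ‖δ‖ := by rw [norm_abs_eq_norm]
    _ ≤ _ := by gcongr

theorem integrable_comp {F : ℝ → ℝ} (hF : Continuous F) {B : ℝ} {u : D.L2}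
    (hu : ∀ᵐ x ∂D.vol, |u x| ≤ B) : Integrable (fun x => F (u x)) D.vol := by
  obtain ⟨M, hM⟩ := (isCompact_Icc (a := -B) (b := B)).exists_bound_of_continuousOn hF.continuousOn
  exact Integrable.of_bound (hF.comp_aestronglyMeasurable (Lp.aestronglyMeasurable u)) M
    (hu.mono fun x hx => hM _ (abs_le.1 hx))

theorem energy_eq {F : ℝ → ℝ} {u : D.H1} (hu : Integrable (fun x => F (fn u x)) D.vol) :
    D.energy F u = 1 / 2 * ‖grad u‖ ^ 2 + ∫ x, F (fn u x) ∂D.vol := by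
  have h1 : Integrable (fun x => ‖grad u x‖ ^ 2) D.vol :=
    (L2.integrable_inner (𝕜 := ℝ) (grad u) (grad u)).congr
      (Eventually.of_forall fun x => real_inner_self_eq_norm_sq _)
  rw [energy, integral_add (h1.const_mul _) hu, integral_const_mul, ← real_inner_self_eq_norm_sq,
    L2.inner_def]
  simp only [real_inner_self_eq_norm_sq]

theorem abs_integral_comp_sub_le {F f : ℝ → ℝ} (hF : ∀ z, HasDerivAt F (f z) z) {B M : ℝ}
    (hM0 : 0 ≤ M) (hM : ∀ z, |z| ≤ B → |f z| ≤ M) {u v : D.L2} (hu : ∀ᵐ x ∂D.vol, |u x| ≤ B)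
    (hv : ∀ᵐ x ∂D.vol, |v x| ≤ B) :
    |(∫ x, F (u x) ∂D.vol) - ∫ x, F (v x) ∂D.vol| ≤ D.sqrtVol * M * ‖u - v‖ := by
  have hFc : Continuous F := continuous_iff_continuousAt.2 fun z => (hF z).continuousAt
  rw [← integral_sub (integrable_comp hFc hu) (integrable_comp hFc hv)]
  have := abs_integral_le (D := D) (Z := fun x => F (u x) - F (v x)) (a := 0) (b := 0)
    (δ := u - v) (C := 0) hM0 le_rfl (by
      filter_upwards [hu, hv, Lp.coeFn_sub u v] with x h1 h2 h3
      rw [h3, Pi.sub_apply, zero_mul, add_zero, add_zero]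
      exact abs_primitive_sub_le_of_bound hF hM h2 h1)
  simpa using this

/-- Change of the energy between two solutions with the same intermediate state. -/
theorem Solves.mul_energy_sub_le {F f : ℝ → ℝ} (hF : ∀ z, HasDerivAt F (f z) z)
    (hf : Continuous f) {β B : ℝ} (hβ : 0 ≤ β) (hβB : β ≤ B) {κ C : ℝ} (hκ : 0 ≤ κ) (hC : 0 ≤ C)
    (h : ∀ a b, |a| ≤ B → |b| ≤ B → |f a - f b| ≤ κ + C * |a - b|) {w : D.L2}
    (hw : ∀ᵐ x ∂D.vol, |w x| ≤ β) {η₁ η₂ : ℝ} (hη₁ : 0 ≤ η₁) (hlt : η₁ < η₂) {ψ₁ ψ₂ : D.H1}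
    (h₁ : Solves (superpos hf hβ w) w η₁ ψ₁) (h₂ : Solves (superpos hf hβ w) w η₂ ψ₂)
    (hb₁ : ∀ᵐ x ∂D.vol, |fn ψ₁ x| ≤ B) (hb₂ : ∀ᵐ x ∂D.vol, |fn ψ₂ x| ≤ B) :
    (η₂ - η₁) * (D.energy F ψ₂ - D.energy F ψ₁) ≤ -‖fn ψ₂ - fn ψ₁‖ ^ 2 +
      (η₂ - η₁) * ((D.sqrtVol * κ + C * ‖fn ψ₁ - w‖ + C * ‖fn ψ₂ - w‖) * ‖fn ψ₂ - fn ψ₁‖) := by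
  have hFc : Continuous F := continuous_iff_continuousAt.2 fun z => (hF z).continuousAt
  have i₁ := integrable_comp hFc hb₁
  have i₂ := integrable_comp hFc hb₂
  set g := superpos hf hβ w with hg
  have key := (abs_le.1 (abs_integral_le (D := D)
    (Z := fun x => (F (fn ψ₂ x) - F (fn ψ₁ x)) - g x * (fn ψ₂ - fn ψ₁) x)
    (a := fn ψ₁ - w) (b := fn ψ₂ - w) (δ := fn ψ₂ - fn ψ₁) hκ hC (by
      filter_upwards [hb₁, hb₂, hw, coeFn_superpos hf hβ hw, Lp.coeFn_sub (fn ψ₁) w,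
        Lp.coeFn_sub (fn ψ₂) w, Lp.coeFn_sub (fn ψ₂) (fn ψ₁)] with x h1 h2 h3 h4 h5 h6 h7
      rw [hg, h4, h5, h6, h7]
      exact abs_primitive_sub_le hF hC h h1 h2 (h3.trans hβB)))).2
  have i₃ : Integrable (fun x => F (fn ψ₂ x) - F (fn ψ₁ x)) D.vol := i₂.sub i₁
  rw [integral_sub i₃ (integrable_mul _ _), integral_sub i₂ i₁, ← inner_L2] at key
  rw [energy_eq i₁, energy_eq i₂]
  -- Expanding the Dirichlet energy around ψ₂ leaves a quadratic remainder of favourable sign.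
  have e := h₁.sub h₂ (ψ₂ - ψ₁)
  simp only [real_inner_self_eq_norm_sq, fn_sub, grad_sub] at e
  have e2 : ‖grad ψ₁‖ ^ 2 = ‖grad ψ₂‖ ^ 2 - 2 * inner ℝ (grad ψ₂) (grad ψ₂ - grad ψ₁) +
      ‖grad ψ₂ - grad ψ₁‖ ^ 2 := by
    have := norm_sub_sq_real (grad ψ₂) (grad ψ₂ - grad ψ₁)
    rwa [sub_sub_cancel] at this
  have ht : 0 < η₂ - η₁ := sub_pos.2 hlt
  have key' := mul_le_mul_of_nonneg_left key ht.le
  have p1 := mul_nonneg hη₁ (sq_nonneg ‖grad ψ₂ - grad ψ₁‖)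
  have p2 := mul_nonneg ht.le (sq_nonneg ‖grad ψ₂ - grad ψ₁‖)
  rw [e2]
  nlinarith

/-- Solutions depend continuously on the multiplier. -/
theorem continuousOn_of_solves {g : D.L2} {W : D.H1} {T : ℝ} (hT : T ≤ 1) {ψ : ℝ → D.H1}
    (h : ∀ η ∈ Set.Icc 0 T, Solves g (fn W) η (ψ η)) : ContinuousOn ψ (Set.Icc 0 T) := by
  intro a ha
  set l := 𝓝[Set.Icc 0 T] a with hl
  have hmem : ∀ᶠ η in l, η ∈ Set.Icc 0 T := self_mem_nhdsWithin
  have hη : Tendsto (fun η : ℝ => η) l (𝓝 a) := tendsto_id.mono_left nhdsWithin_le_nhds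
  set R := √(1 * (‖grad W‖ ^ 2 + ‖g‖ ^ 2)) with hR
  set G := ‖grad W‖ + ‖g‖ * R + 1 with hG
  have hfb : ∀ η ∈ Set.Icc 0 T, ‖fn (ψ η) - fn W‖ ≤ R := fun η hη => by
    refine ((h η hη).norm_fn_sub_le hη.1 (hη.2.trans hT)).trans (Real.sqrt_le_sqrt ?_)
    have := hη.2.trans hT
    gcongr
  have hgb : ∀ η ∈ Set.Icc 0 T, ‖grad (ψ η)‖ ≤ G := fun η hη => by
    refine ((h η hη).norm_grad_le hη.1).trans ?_
    have := hfb η hη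
    rw [hG]
    gcongr
  set r : ℝ → ℝ := fun η => inner ℝ (grad (ψ a)) (grad (ψ a - ψ η)) +
    inner ℝ g (fn (ψ a - ψ η)) with hr
  have e : ∀ η ∈ Set.Icc 0 T, ‖fn (ψ a - ψ η)‖ ^ 2 + η * ‖grad (ψ a - ψ η)‖ ^ 2 =
      (η - a) * r η := fun η hη => by
    have := (h η hη).sub (h a ha) (ψ a - ψ η)
    rwa [real_inner_self_eq_norm_sq, real_inner_self_eq_norm_sq, neg_sub] at this
  set Q := G * (G + G) + ‖g‖ * (R + R) with hQ
  have hrQ : ∀ η ∈ Set.Icc 0 T, |r η| ≤ Q := fun η hη => by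
    have h1 : ‖grad (ψ a - ψ η)‖ ≤ G + G := by
      rw [grad_sub]
      exact (norm_sub_le _ _).trans (add_le_add (hgb a ha) (hgb η hη))
    have h2 : ‖fn (ψ a - ψ η)‖ ≤ R + R := by
      rw [fn_sub, ← sub_sub_sub_cancel_right _ _ (fn W)]
      exact (norm_sub_le _ _).trans (add_le_add (hfb a ha) (hfb η hη))
    have h3 := hgb a ha
    refine (abs_add_le _ _).trans (add_le_add ?_ ?_)
    · refine (abs_real_inner_le_norm _ _).trans ?_
      gcongr
    · refine (abs_real_inner_le_norm _ _).trans ?_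
      gcongr
  have hsmall : ∀ η ∈ Set.Icc 0 T, (η - a) * r η ≤ |η - a| * Q := fun η hη => by
    refine (le_abs_self _).trans ?_
    rw [abs_mul]
    exact mul_le_mul_of_nonneg_left (hrQ η hη) (abs_nonneg _)
  have hlim0 : Tendsto (fun η => |η - a| * Q) l (𝓝 0) := by
    simpa using ((hη.sub_const a).abs).mul_const Q
  have hfn : Tendsto (fun η => ‖fn (ψ a - ψ η)‖) l (𝓝 0) := by
    have h1 : Tendsto (fun η => √(|η - a| * Q)) l (𝓝 0) := by simpa using hlim0.sqrt
    refine squeeze_zero' (Eventually.of_forall fun _ => norm_nonneg _) ?_ h1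
    filter_upwards [hmem] with η hη
    refine Real.le_sqrt_of_sq_le ?_
    nlinarith [e η hη, hsmall η hη, mul_nonneg hη.1 (sq_nonneg ‖grad (ψ a - ψ η)‖)]
  have hgrad : Tendsto (fun η => ‖grad (ψ a - ψ η)‖) l (𝓝 0) := by
    obtain ⟨m, hm0, hm⟩ : ∃ m : ℝ → ℝ, Tendsto m l (𝓝 0) ∧
        ∀ᶠ η in l, ‖grad (ψ a - ψ η)‖ ^ 2 ≤ m η := by
      -- For a > 0 the term η‖∇(ψ a - ψ η)‖² controls the gradient. At a = 0 that control
      -- degenerates, but dividing the identity by η leaves ‖∇(ψ a - ψ η)‖² ≤ r η, and r η tends to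
      -- 0 by weak convergence.
      rcases eq_or_lt_of_le ha.1 with rfl | ha0
      · refine ⟨r, ?_, ?_⟩
        · have hconv : Tendsto (fun η => fn (ψ 0 - ψ η)) l (𝓝 (fn (0 : D.H1))) := by
            rw [fn_zero]
            exact tendsto_zero_iff_norm_tendsto_zero.2 hfn
          have h1 := tendsto_inner_grad hconv (G + G) (by
            filter_upwards [hmem] with η hη
            rw [grad_sub]
            exact (norm_sub_le _ _).trans (add_le_add (hgb 0 ha) (hgb η hη))) (ψ 0)
          have h2 := h1.add (hconv.inner (tendsto_const_nhds (x := g)))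
          rw [grad_zero, fn_zero, inner_zero_left, inner_zero_left, add_zero] at h2
          refine h2.congr fun η => ?_
          rw [real_inner_comm, real_inner_comm g]
        · filter_upwards [hmem] with η hη
          rcases eq_or_lt_of_le hη.1 with rfl | hpos
          · simp [hr]
          · have h1 := e η hη
            rw [sub_zero] at h1
            refine le_of_mul_le_mul_left ?_ hpos
            nlinarith [sq_nonneg ‖fn (ψ 0 - ψ η)‖]
      · refine ⟨fun η => |η - a| * Q / η, ?_, ?_⟩
        · have h1 : Tendsto (fun η => |η - a| * Q / η) l (𝓝 (0 / a)) := hlim0.div hη ha0.ne'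
          rwa [zero_div] at h1
        · filter_upwards [hmem, hη.eventually (lt_mem_nhds ha0)] with η hη hpos
          rw [le_div_iff₀ hpos]
          nlinarith [e η hη, hsmall η hη, sq_nonneg ‖fn (ψ a - ψ η)‖]
    have h1 : Tendsto (fun η => √(m η)) l (𝓝 0) := by simpa using hm0.sqrt
    refine squeeze_zero' (Eventually.of_forall fun _ => norm_nonneg _) ?_ h1
    filter_upwards [hm] with η hη using Real.le_sqrt_of_sq_le hη
  have hsum : Tendsto (fun η => ‖fn (ψ a - ψ η)‖ + ‖grad (ψ a - ψ η)‖) l (𝓝 0) := by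
    simpa using hfn.add hgrad
  change Tendsto ψ l (𝓝 (ψ a))
  rw [tendsto_iff_norm_sub_tendsto_zero]
  refine squeeze_zero (fun _ => norm_nonneg _) (fun η => ?_) hsum
  rw [norm_sub_rev]
  exact norm_le_add _

end Domain
end PCC

/-! ### Solvability of the energy projection and the decay rate -/

namespace PCC
namespace Domain

variable {d : ℕ} {D : Domain d}

/-- The energy of the solution is a continuous function of the multiplier. -/
theorem continuousOn_energy {F f : ℝ → ℝ} (hF : ∀ z, HasDerivAt F (f z) z) (hf : Continuous f)
    {B : ℝ} (hB : 0 ≤ B) {S : Set ℝ} {ψ : ℝ → D.H1} (hψ : ContinuousOn ψ S)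
    (hb : ∀ η ∈ S, ∀ᵐ x ∂D.vol, |fn (ψ η) x| ≤ B) :
    ContinuousOn (fun η => D.energy F (ψ η)) S := by
  have hFc : Continuous F := continuous_iff_continuousAt.2 fun z => (hF z).continuousAt
  obtain ⟨M, hM0, hM⟩ := exists_bound_comp_clip hf hB
  have h2 : ContinuousOn (fun η => ∫ x, F (fn (ψ η) x) ∂D.vol) S := by
    intro a ha
    change Tendsto _ _ _
    rw [tendsto_iff_norm_sub_tendsto_zero]
    have hlim : Tendsto (fun η => D.sqrtVol * M * ‖fn (ψ η) - fn (ψ a)‖) (𝓝[S] a) (𝓝 0) := by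
      have h1 : Tendsto (fun η => fn (ψ η)) (𝓝[S] a) (𝓝 (fn (ψ a))) :=
        (continuous_fn.tendsto _).comp (hψ a ha)
      simpa using (tendsto_iff_norm_sub_tendsto_zero.1 h1).const_mul (D.sqrtVol * M)
    refine squeeze_zero' (Eventually.of_forall fun _ => norm_nonneg _) ?_ hlim
    filter_upwards [self_mem_nhdsWithin] with η hη
    exact abs_integral_comp_sub_le hF hM0 hM (hb η hη) (hb a ha)
  refine ContinuousOn.congr (f := fun η => 1 / 2 * ‖grad (ψ η)‖ ^ 2 +
    ∫ x, F (fn (ψ η) x) ∂D.vol) ?_ fun η hη => energy_eq (integrable_comp hFc (hb η hη))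
  exact (((continuous_grad.comp_continuousOn hψ).norm.pow 2).const_mul _).add h2

/-- Unique solvability of the energy projection when the energy of the solution decreases at a
definite rate and the energy of the intermediate state is close to that of the old state. -/
theorem existsUnique_isEnergyProjection {F f : ℝ → ℝ} (hF : ∀ z, HasDerivAt F (f z) z)
    (hf : Continuous f) {β B : ℝ} (hβ : 0 ≤ β) (hB : 0 ≤ B) {φ W : D.H1}
    (hW : ∀ᵐ x ∂D.vol, |fn W x| ≤ β) {T k : ℝ} (hT : 0 < T) (hT1 : T ≤ 1) (hk : 0 < k)
    (hb : ∀ η ∈ Set.Icc 0 T, ∀ ψ, Solves (superpos hf hβ (fn W)) (fn W) η ψ →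
      ∀ᵐ x ∂D.vol, |fn ψ x| ≤ B)
    (hdrop : ∀ η₁ η₂ : ℝ, 0 ≤ η₁ → η₁ < η₂ → η₂ ≤ T → ∀ ψ₁ ψ₂ : D.H1,
      Solves (superpos hf hβ (fn W)) (fn W) η₁ ψ₁ → Solves (superpos hf hβ (fn W)) (fn W) η₂ ψ₂ →
      D.energy F ψ₂ - D.energy F ψ₁ ≤ -(k * (η₂ - η₁)))
    (hE : D.energy F W - D.energy F φ ≤ k * T) :
    ∃! s : ℝ × D.H1, s.1 ≤ T ∧ D.IsEnergyProjection F f φ (fn W) s.1 s.2 := by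
  have hFc : Continuous F := continuous_iff_continuousAt.2 fun z => (hF z).continuousAt
  -- The choice is made total in η; values at negative η are irrelevant.
  have hex : ∀ η : ℝ, ∃ ψ, 0 ≤ η → Solves (superpos hf hβ (fn W)) (fn W) η ψ := fun η => by
    by_cases hη : 0 ≤ η
    · obtain ⟨ψ, hψ⟩ := exists_solves (superpos hf hβ (fn W)) W hη
      exact ⟨ψ, fun _ => hψ⟩
    · exact ⟨0, fun h => absurd h hη⟩
  choose ψ hψ using hex
  have hψ0 : ψ 0 = W := (hψ 0 le_rfl).unique le_rfl fun v => by simp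
  have hchar : ∀ η ψ', D.IsEnergyProjection F f φ (fn W) η ψ' → ψ' = ψ η := fun η ψ' h =>
    ((eqn_iff_solves hf hβ hW η ψ').1 h.eqn).unique h.multiplier_nonneg (hψ η h.multiplier_nonneg)
  have hdrop' : ∀ η₁ η₂ : ℝ, 0 ≤ η₁ → η₁ < η₂ → η₂ ≤ T →
      D.energy F (ψ η₂) - D.energy F (ψ η₁) ≤ -(k * (η₂ - η₁)) := fun η₁ η₂ h0 hlt h2 =>
    hdrop η₁ η₂ h0 hlt h2 _ _ (hψ η₁ h0) (hψ η₂ (h0.trans hlt.le))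
  have hanti : ∀ η₁ η₂ : ℝ, 0 ≤ η₁ → η₁ < η₂ → η₂ ≤ T → D.energy F (ψ η₂) < D.energy F (ψ η₁) :=
    fun η₁ η₂ h0 hlt h2 => by
      have h1 := hdrop' η₁ η₂ h0 hlt h2
      have h3 := mul_pos hk (sub_pos.2 hlt)
      linarith
  suffices hmain : ∃ η, 0 ≤ η ∧ η ≤ T ∧ D.energy F (ψ η) ≤ D.energy F φ ∧
      η * (D.energy F (ψ η) - D.energy F φ) = 0 by
    obtain ⟨η, h0, h1, h2, h3⟩ := hmain
    refine ⟨(η, ψ η), ⟨h1, (eqn_iff_solves hf hβ hW η _).2 (hψ η h0), h0,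
      integrable_comp hFc (hb η ⟨h0, h1⟩ _ (hψ η h0)), sub_nonpos.2 h2, h3⟩, ?_⟩
    rintro ⟨η', ψ'⟩ ⟨h1', hs⟩
    have hψ' := hchar η' ψ' hs
    have h0' := hs.multiplier_nonneg
    have h2' := sub_nonpos.1 hs.energy_le
    have h3' := hs.complementary
    dsimp only at h1' h0' h2' h3' hψ'
    subst hψ'
    suffices η' = η by rw [this]
    -- Of two solutions the larger multiplier is positive, so its energy equals that of φ; strict
    -- decrease would then put the smaller one above φ.
    rcases lt_trichotomy η' η with hlt | heq | hlt
    · have h4 := hanti η' η h0' hlt h1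
      rcases mul_eq_zero.1 h3 with h5 | h5 <;> linarith
    · exact heq
    · have h4 := hanti η η' h0 hlt h1'
      rcases mul_eq_zero.1 h3' with h5 | h5 <;> linarith
  rcases le_or_gt (D.energy F W) (D.energy F φ) with hle | hgt
  · exact ⟨0, le_rfl, hT.le, by rwa [hψ0], zero_mul _⟩
  · have hcont : ContinuousOn (fun η => D.energy F (ψ η)) (Set.Icc 0 T) :=
      continuousOn_energy hF hf hB (continuousOn_of_solves hT1 fun η hη => hψ η hη.1)
        fun η hη => hb η hη _ (hψ η hη.1)
    have hT2 := hdrop' 0 T le_rfl hT le_rfl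
    rw [hψ0, sub_zero] at hT2
    obtain ⟨η, hη, he⟩ := intermediate_value_Icc' hT.le hcont
      (show D.energy F φ ∈ Set.Icc (D.energy F (ψ T)) (D.energy F (ψ 0)) from
        ⟨by linarith, by rw [hψ0]; exact hgt.le⟩)
    exact ⟨η, hη.1, hη.2, he.le, by simp only at he; rw [he, sub_self, mul_zero]⟩

/-- The maximum bound is preserved by one time step. -/
theorem IsStep.maxBound {F f : ℝ → ℝ} (hf : Continuous f) {β : ℝ} (hβ : 0 < β) {Φ : D.H1 → D.H1}
    {φ ψ : D.H1} {η : ℝ} (hstep : ∀ z, |z| ≤ β → |z - η * f z| ≤ β)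
    (h : D.IsStep F f β Φ φ η ψ) : D.MaxBound β (fn ψ) := by
  obtain ⟨w, hw, hs⟩ := h
  rw [isBoundProjection_iff hβ] at hw
  have hwb : ∀ᵐ x ∂D.vol, |w x| ≤ β := by
    filter_upwards [coeFn_clipLp hβ.le (fn (Φ φ))] with x hx
    rw [hw, hx]
    exact abs_clip_le hβ.le _
  rw [maxBound_iff hβ.le]
  refine ((eqn_iff_solves hf hβ.le hwb η ψ).1 hs.eqn).ae_abs_le hs.multiplier_nonneg hβ.le ?_
  filter_upwards [hwb, coeFn_superpos hf hβ.le hwb] with x h1 h2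
  rw [h2]
  exact hstep _ h1

/-- Near a compact set of unsteady states, the energy of the solution decreases at a definite rate
as a function of the multiplier. -/
theorem exists_energy_drop {F f : ℝ → ℝ} (hF : ∀ z, HasDerivAt F (f z) z) (hf : Continuous f)
    {β B : ℝ} (hβ : 0 ≤ β) (hβB : β ≤ B) {K : Set D.H1} (hK : IsCompact K)
    (hbound : ∀ φ ∈ K, ∀ᵐ x ∂D.vol, |fn φ x| ≤ β) {ε : ℝ} (hε : 0 < ε)
    (hun : ∀ φ ∈ K, D.Unsteady f ε φ) :
    ∃ ρ, 0 < ρ ∧ ρ ≤ 1 ∧ ∃ k, 0 < k ∧ ∀ φ ∈ K, ∀ W : D.H1, (∀ᵐ x ∂D.vol, |fn W x| ≤ β) →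
      ‖fn W - fn φ‖ ≤ ρ → ‖grad W‖ ≤ ‖grad φ‖ + 1 →
      ∀ η₁ η₂ : ℝ, 0 ≤ η₁ → η₁ < η₂ → η₂ ≤ ρ → ∀ ψ₁ ψ₂ : D.H1,
      Solves (superpos hf hβ (fn W)) (fn W) η₁ ψ₁ → Solves (superpos hf hβ (fn W)) (fn W) η₂ ψ₂ →
      (∀ᵐ x ∂D.vol, |fn ψ₁ x| ≤ B) → (∀ᵐ x ∂D.vol, |fn ψ₂ x| ≤ B) →
      D.energy F ψ₂ - D.energy F ψ₁ ≤ -(k * (η₂ - η₁)) := by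
  obtain ⟨ρ, hρ, hspeed⟩ := exists_speed_lower_bound hf hβ hK hbound hε hun
  set c := √ε / 2 with hc
  have hc0 : 0 < c := by positivity
  have hV := D.sqrtVol_nonneg
  obtain ⟨C, hC, hmod⟩ := exists_abs_sub_le_add_mul hf B (κ := c / (4 * (D.sqrtVol + 1)))
    (by positivity)
  set κ := c / (4 * (D.sqrtVol + 1)) with hκ
  have hκ0 : 0 < κ := by positivity
  have hκc : D.sqrtVol * κ ≤ c / 4 := by
    rw [hκ, mul_div_assoc', div_le_div_iff₀ (by positivity) (by positivity)]
    nlinarith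
  obtain ⟨G, hG0, hG⟩ := hK.isBounded.exists_pos_norm_le
  obtain ⟨M, hM, hfM⟩ := exists_bound_comp_clip hf hβ
  set A := (G + 1) ^ 2 + (D.sqrtVol * M) ^ 2 with hA
  have hA0 : 0 < A := by positivity
  have hlim : Tendsto (fun η : ℝ => C * √(η * A) + C * √(η * A)) (𝓝[>] 0) (𝓝 0) := by
    have hc : Continuous fun η : ℝ => C * √(η * A) + C * √(η * A) := by fun_prop
    have := hc.tendsto 0
    simp only [zero_mul, Real.sqrt_zero, mul_zero, add_zero] at this
    exact this.mono_left nhdsWithin_le_nhds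
  -- The κ part and the displacement part of the error are each at most c/4. Their sum c/2 costs at
  -- most half of ‖δ‖² because ‖δ‖ ≥ ct, whence the rate c²/2.
  obtain ⟨ρ', h1, h2, h3⟩ := ((hlim.eventually (eventually_le_nhds (show 0 < c / 4 by positivity))).and
    ((Ioc_mem_nhdsGT (show 0 < min ρ 1 by positivity)))).exists
  rw [le_min_iff] at h3
  refine ⟨ρ', h2, h3.2, c ^ 2 / 2, by positivity, ?_⟩
  intro φ hφ W hWβ hWφ hWg η₁ η₂ h0 hlt hle ψ₁ ψ₂ hs₁ hs₂ hb₁ hb₂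
  have hsp := hspeed φ hφ W (hWφ.trans h3.1) hWg η₁ η₂ h0 hlt (hle.trans h3.1) ψ₁ ψ₂ hs₁ hs₂
  have hdist : ∀ η ψ, 0 ≤ η → η ≤ ρ' → Solves (superpos hf hβ (fn W)) (fn W) η ψ →
      ‖fn ψ - fn W‖ ≤ √(ρ' * A) := fun η ψ hη hηρ hs => by
    refine (hs.norm_fn_sub_le hη (hηρ.trans h3.2)).trans (Real.sqrt_le_sqrt ?_)
    have h4 := norm_superpos_le (D := D) hf hβ hM hfM (fn W)
    have h5 : ‖grad W‖ ≤ G + 1 := hWg.trans (by linarith [(norm_grad_le φ).trans (hG φ hφ)])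
    rw [hA]
    gcongr
  have hd₁ := mul_le_mul_of_nonneg_left (hdist η₁ ψ₁ h0 (hlt.le.trans hle) hs₁) hC
  have hd₂ := mul_le_mul_of_nonneg_left (hdist η₂ ψ₂ (h0.trans hlt.le) hle hs₂) hC
  have key := Solves.mul_energy_sub_le hF hf hβ hβB hκ0.le hC hmod hWβ h0 hlt hs₁ hs₂ hb₁ hb₂
  set x := ‖fn ψ₂ - fn ψ₁‖ with hx
  set t := η₂ - η₁ with ht
  have ht0 : 0 < t := sub_pos.2 hlt
  have hx0 : 0 ≤ x := norm_nonneg _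
  have h6 : t * ((D.sqrtVol * κ + C * ‖fn ψ₁ - fn W‖ + C * ‖fn ψ₂ - fn W‖) * x) ≤
      t * (c / 2 * x) := by
    refine mul_le_mul_of_nonneg_left (mul_le_mul_of_nonneg_right ?_ hx0) ht0.le
    linarith
  refine le_of_mul_le_mul_left ?_ ht0
  refine (key.trans (add_le_add_right h6 _)).trans ?_
  have h7 : 0 ≤ (x - c * t) * x := mul_nonneg (sub_nonneg.2 hsp) hx0
  have h8 : 0 ≤ (x - c * t) * (c * t) := mul_nonneg (sub_nonneg.2 hsp) (by positivity)
  nlinarith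

end Domain
end PCC
end

/-! ### Choice of constants and conclusion -/

theorem mainTheorem5 {d : ℕ} (D : PCC.Domain d) (F f : ℝ → ℝ)
    (hF : ∀ z, HasDerivAt F (f z) z) (hf : Continuous f) (β : ℝ) (hβ : 0 < β)
    (Φ : ℝ → D.H1 → D.H1) (K : Set D.H1) (hK : IsCompact K)
    (hΦ : TendstoUniformlyOn Φ id (𝓝[>] (0 : ℝ)) K)
    (hbound : ∀ φ ∈ K, D.MaxBound β (PCC.Domain.fn φ))
    (ε : ℝ) (hε : 0 < ε) (hunsteady : ∀ φ ∈ K, D.Unsteady f ε φ) :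
    ∃ τ₂ : ℝ, 0 < τ₂ ∧ ∃ ηmax : ℝ, 0 < ηmax ∧ ∀ τ : ℝ, 0 < τ → τ < τ₂ →
      (∀ φ ∈ K,
        (∃! w : D.L2, D.IsBoundProjection β (PCC.Domain.fn (Φ τ φ)) w) ∧
        ∀ w : D.L2, D.IsBoundProjection β (PCC.Domain.fn (Φ τ φ)) w →
          ∃! s : ℝ × D.H1, s.1 ≤ ηmax ∧ D.IsEnergyProjection F f φ w s.1 s.2) ∧
      (PCC.SignCondition f β →
        ∀ (N : ℕ) (φ : ℕ → D.H1) (η : ℕ → ℝ),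
          D.MaxBound β (PCC.Domain.fn (φ 0)) →
          (∀ n < N, η (n + 1) ≤ ηmax ∧ D.IsStep F f β (Φ τ) (φ n) (η (n + 1)) (φ (n + 1))) →
          (∀ n ≤ N, D.MaxBound β (PCC.Domain.fn (φ n))) ∧
          ∀ n < N, D.energy F (φ (n + 1)) ≤ D.energy F (φ n)) := by
  have hFc : Continuous F := continuous_iff_continuousAt.2 fun z => (hF z).continuousAt
  have hbound' : ∀ φ ∈ K, ∀ᵐ x ∂D.vol, |PCC.Domain.fn φ x| ≤ β := fun φ hφ =>
    (PCC.Domain.maxBound_iff hβ.le _).1 (hbound φ hφ)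
  obtain ⟨M, hM, hfM⟩ := PCC.Domain.exists_bound_comp_clip hf hβ.le
  obtain ⟨ρ, hρ, hρ1, k, hk, hdrop⟩ := PCC.Domain.exists_energy_drop hF hf hβ.le
    (show β ≤ β + M by linarith) hK hbound' hε hunsteady
  obtain ⟨L, hL, hstep⟩ : ∃ L, 0 ≤ L ∧ (PCC.SignCondition f β →
      ∀ η z : ℝ, 0 ≤ η → η * L ≤ 1 → |z| ≤ β → |z - η * f z| ≤ β) := by
    by_cases h : PCC.SignCondition f β
    · obtain ⟨L, hL, h'⟩ := h.exists_step hβ.le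
      exact ⟨L, hL, fun _ => h'⟩
    · exact ⟨0, le_rfl, fun h' => absurd h' h⟩
  -- T serves as the multiplier bound: T ≤ ρ ensures energy decay, T L ≤ 1 the invariance of [-β,
  -- β]. It is fixed before τ₂.
  obtain ⟨T, hT, hTρ, hTL⟩ : ∃ T, 0 < T ∧ T ≤ ρ ∧ T * L ≤ 1 := by
    refine ⟨min ρ (1 / (L + 1)), by positivity, min_le_left _ _, ?_⟩
    calc min ρ (1 / (L + 1)) * L ≤ 1 / (L + 1) * L := by gcongr; exact min_le_right _ _
      _ ≤ 1 := by
        rw [one_div_mul_eq_div]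
        exact div_le_one_of_le₀ (by linarith) (by linarith)
  have hT1 : T ≤ 1 := hTρ.trans hρ1
  obtain ⟨G, hG0, hG⟩ := hK.isBounded.exists_pos_norm_le
  have hV := D.sqrtVol_nonneg
  -- If the predictor is within r of φ in H¹, then E[W] - E[φ] ≤ Gr + r²/2 + `sqrtVol` * M * r,
  -- which is at most kT because r ≤ 1.
  obtain ⟨r, hr, hrρ, hrT⟩ : ∃ r, 0 < r ∧ r ≤ ρ ∧ (G + 1 + D.sqrtVol * M) * r ≤ k * T := by
    refine ⟨min ρ (k * T / (G + 1 + D.sqrtVol * M)), by positivity, min_le_left _ _, ?_⟩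
    calc (G + 1 + D.sqrtVol * M) * min ρ (k * T / (G + 1 + D.sqrtVol * M))
        ≤ (G + 1 + D.sqrtVol * M) * (k * T / (G + 1 + D.sqrtVol * M)) := by
          gcongr; exact min_le_right _ _
      _ = k * T := by field_simp
  have hev := Metric.tendstoUniformlyOn_iff.1 hΦ r hr
  obtain ⟨τ₂, hτ₂, hτ⟩ := mem_nhdsGT_iff_exists_Ioo_subset.1 hev
  refine ⟨τ₂, hτ₂, T, hT, fun τ hτ0 hττ => ⟨fun φ hφ => ⟨?_, ?_⟩, ?_⟩⟩
  · refine ⟨D.clipLp hβ.le (PCC.Domain.fn (Φ τ φ)), ?_, fun w hw => ?_⟩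
    · exact (PCC.Domain.isBoundProjection_iff hβ _ _).2 rfl
    · exact (PCC.Domain.isBoundProjection_iff hβ _ _).1 hw
  · intro w hw
    rw [PCC.Domain.isBoundProjection_iff hβ] at hw
    obtain ⟨W, hW, hWg⟩ := PCC.Domain.exists_clip (Φ τ φ) hβ.le
    rw [← hW] at hw
    subst hw
    have hclose : ‖Φ τ φ - φ‖ ≤ r := by
      have := hτ ⟨hτ0, hττ⟩ φ hφ
      rw [dist_comm, dist_eq_norm] at this
      exact this.le
    have hWβ : ∀ᵐ x ∂D.vol, |PCC.Domain.fn W x| ≤ β := by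
      filter_upwards [PCC.Domain.coeFn_clipLp hβ.le (PCC.Domain.fn (Φ τ φ))] with x hx
      rw [hW, hx]
      exact PCC.abs_clip_le hβ.le _
    have hφclip : D.clipLp hβ.le (PCC.Domain.fn φ) = PCC.Domain.fn φ := by
      refine Lp.ext ?_
      filter_upwards [PCC.Domain.coeFn_clipLp hβ.le (PCC.Domain.fn φ), hbound' φ hφ] with x h1 h2
      rw [h1, PCC.clip_of_abs_le h2]
    have hWφ : ‖PCC.Domain.fn W - PCC.Domain.fn φ‖ ≤ r := by
      rw [hW, ← hφclip]
      refine (PCC.Domain.norm_clipLp_sub_le hβ.le _ _).trans ?_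
      rw [← PCC.Domain.fn_sub]
      exact (PCC.Domain.norm_fn_le _).trans hclose
    have hWG : ‖PCC.Domain.grad W‖ ≤ ‖PCC.Domain.grad φ‖ + r := by
      have h1 := norm_le_norm_add_norm_sub (PCC.Domain.grad φ) (PCC.Domain.grad (Φ τ φ))
      rw [norm_sub_rev, ← PCC.Domain.grad_sub] at h1
      linarith [(PCC.Domain.norm_grad_le (Φ τ φ - φ)).trans hclose]
    have hr1 : r ≤ 1 := hrρ.trans hρ1
    have hb : ∀ η ∈ Set.Icc 0 T, ∀ ψ, PCC.Domain.Solves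
        (PCC.Domain.superpos hf hβ.le (PCC.Domain.fn W)) (PCC.Domain.fn W) η ψ →
        ∀ᵐ x ∂D.vol, |PCC.Domain.fn ψ x| ≤ β + M := fun η hη ψ hs => by
      refine hs.ae_abs_le hη.1 (by linarith) ?_
      filter_upwards [hWβ, PCC.Domain.coeFn_superpos hf hβ.le hWβ] with x h1 h2
      rw [h2]
      refine (abs_sub _ _).trans (add_le_add h1 ?_)
      rw [abs_mul, abs_of_nonneg hη.1]
      exact (mul_le_of_le_one_left (abs_nonneg _) (hη.2.trans hT1)).trans (hfM _ h1)
    refine PCC.Domain.existsUnique_isEnergyProjection hF hf hβ.le (show 0 ≤ β + M by linarith)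
      hWβ hT hT1 hk hb (fun η₁ η₂ h0 hlt hle ψ₁ ψ₂ hs₁ hs₂ => ?_) ?_
    · exact hdrop φ hφ W hWβ (hWφ.trans hrρ) (hWG.trans (by linarith)) η₁ η₂ h0 hlt
        (hle.trans hTρ) ψ₁ ψ₂ hs₁ hs₂ (hb η₁ ⟨h0, hlt.le.trans hle⟩ ψ₁ hs₁)
        (hb η₂ ⟨h0.trans hlt.le, hle⟩ ψ₂ hs₂)
    · rw [PCC.Domain.energy_eq (PCC.Domain.integrable_comp hFc hWβ),
        PCC.Domain.energy_eq (PCC.Domain.integrable_comp hFc (hbound' φ hφ))]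
      have h1 := (abs_le.1 (PCC.Domain.abs_integral_comp_sub_le hF hM hfM hWβ (hbound' φ hφ))).2
      have h2 := mul_le_mul_of_nonneg_left hWφ (mul_nonneg hV hM)
      have h3 : ‖PCC.Domain.grad W‖ ^ 2 ≤ (‖PCC.Domain.grad φ‖ + r) ^ 2 := by gcongr
      have h4 : ‖PCC.Domain.grad φ‖ * r ≤ G * r := by
        gcongr
        exact (PCC.Domain.norm_grad_le φ).trans (hG φ hφ)
      nlinarith
  · intro hsign N φ η h0 hsteps
    refine ⟨fun n hn => ?_, fun n hn => ?_⟩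
    · rcases n with _ | n
      · exact h0
      · obtain ⟨hη, hst⟩ := hsteps n (by omega)
        have hη0 : 0 ≤ η (n + 1) := by
          obtain ⟨w, -, hs⟩ := hst
          exact hs.multiplier_nonneg
        -- The bound on the previous state is not used: the projection in step 2 restores it at
        -- every step.
        refine hst.maxBound hf hβ fun z hz => hstep hsign _ z hη0 ?_ hz
        exact (mul_le_mul_of_nonneg_right hη hL).trans hTL
    · obtain ⟨-, w, -, hs⟩ := hsteps n hn
      exact sub_nonpos.1 hs.energy_le
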